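/- Let $0\le q<p$ be integers and let $a(z)=z^p+a_1z^{p-1}+\cdots+a_p$ and $b(z)=b_0+b_1z+\cdots+b_{q-1}z^{q-1}+z^q$ be real polynomials without common zeroes, all zeroes $\lambda_1,\dots,\lambda_p$ of $a$ (with multiplicity) having negative real part. Let $L=(L_t)_{t\in\mathbb R}$ be a second-order zero-mean Lévy process with $E L_1^2=\sigma^2$, $\sigma>0$, and let $Y=(Y_t)_{t\in\mathbb R}$ be a CARMA$(p,q)$ process driven by $L$, that is, a strictly stationary process $Y_t=\mathbf b^\top \mathbf X_t$, where $\mathbf b=(b_0,\dots,b_{p-1})^\top$ with $b_q=1$ and $b_j=0$ for $j>q$, and where $\mathbf X$ solves $d\mathbf X_t=A\mathbf X_t\,dt+\mathbf e_p\,dL_t$, with $A$ the companion matrix of $a$ (ones above the diagonal, last row $-a_p,\dots,-a_1$) and $\mathbf e_p$ the last standard basis vector. For $\Delta>0$ put $Y^\Delta_n=Y_{n\Delta}$, $n\in\mathbb Z$, and $\phi(B)=\prod_{j=1}^p(1-e^{\lambda_j\Delta}B)$, where $B$ is the backward shift. For a zero-mean weakly stationary sequence with summable autocovariance function $\gamma$,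 the spectral density is $f(\omega)=\frac1{2\pi}\sum_{h\in\mathbb Z}\gamma(h)e^{-ih\omega}$. For every $\Delta>0$ the sequence $\phi(B)Y^\Delta$ is zero-mean and weakly stationary, and its autocovariances vanish at all lags $h$ with $|h|\ge p$. Let $f_{MA}$ denote its spectral density. In any ARMA representation $\phi(B)Y^\Delta_n=\theta(B)Z_n$ with $\theta(z)=1+\theta_1z+\cdots+\theta_{p-1}z^{p-1}$ and $(Z_n)$ zero-mean uncorrelated with constant variance, $f_{MA}$ is the spectral density of the moving average $(\theta(B)Z_n)_{n\in\mathbb Z}$. For every fixed $\omega\in[-\pi,\pi]$ with $\omega\ne0$, as $\Delta\downarrow0$, $$f_{MA}(\omega)\sim\frac{\sigma^2}{2\pi}(-1)^{p-q-1}\Delta^{2(p-q)-1}c_{p-q-1}(\omega)\,2^{p-1}(1-\cos\omega)^p,$$ meaning that the ratio of the two sides tends to $1$. Here $c_k(\omega)$ is the coefficient of $x^{2k+1}$ in the power series expansion, convergent for $x$ near $0$, $$\frac{\sinh x}{\cosh x-\cos\omega}=\sum_{k=0}^\infty c_k(\omega)x^{2k+1}.$$ In particular, $$c_0(\omega)=\frac1{1-\cos\omega},\qquad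 c_1(\omega)=-\frac{2+\cos\omega}{6(1-\cos\omega)^2},\qquad c_2(\omega)=\frac{33+26\cos\omega+\cos(2\omega)}{240(1-\cos\omega)^3}.$$ -/

import Mathlib

open MeasureTheory ProbabilityTheory Filter Topology Polynomial
open scoped Matrix

noncomputable section

namespace CARMA

variable {Ω : Type*} [MeasurableSpace Ω]

/-- A two-sided real Lévy process: it vanishes at time zero, has independent and stationary
increments, is continuous in probability, and almost all its paths are right-continuous with
left limits. -/
structure IsLevyProcess (P : Measure Ω) (L : ℝ → Ω → ℝ) : Prop where
  measurable : ∀ t, Measurable (L t)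
  zero : ∀ᵐ ω ∂P, L 0 ω = 0
  indep_increments : HasIndepIncrements L P
  stationary_increments : ∀ s t h : ℝ,
    IdentDistrib (fun ω => L (t + h) ω - L (s + h) ω) (fun ω => L t ω - L s ω) P P
  stochastic_continuity : ∀ t, TendstoInMeasure P L (𝓝 t) (L t)
  cadlag : ∀ᵐ ω ∂P, ∀ t, ContinuousWithinAt (fun s => L s ω) (Set.Ici t) t ∧
    ∃ l, Tendsto (fun s => L s ω) (𝓝[<] t) (𝓝 l)

/-- A second-order zero-mean Lévy process `L` with `E L₁² = σ²`. -/
structure IsSecondOrderLevy (P : Measure Ω) (L : ℝ → Ω → ℝ) (σ : ℝ) : Prop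
    extends IsLevyProcess P L where
  memLp_two : ∀ t, MemLp (L t) 2 P
  mean_zero : ∀ t, ∫ ω, L t ω ∂P = 0
  second_moment : ∫ ω, (L 1 ω) ^ 2 ∂P = σ ^ 2

/-- Strict stationarity: the finite-dimensional distributions are invariant under time shifts. -/
def IsStrictlyStationary (P : Measure Ω) (Y : ℝ → Ω → ℝ) : Prop :=
  ∀ (h : ℝ) (n : ℕ) (t : Fin n → ℝ),
    IdentDistrib (fun ω i => Y (t i + h) ω) (fun ω i => Y (t i) ω) P P

/-- The companion matrix of `a(z) = z ^ p + a₁ z ^ (p - 1) + ⋯ + a_p`: ones above the diagonal,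
last row `-a_p, …, -a₁`, where `a_{p-j} = a.coeff j`. -/
def stateMatrix (p : ℕ) (a : ℝ[X]) : Matrix (Fin p) (Fin p) ℝ :=
  Matrix.of fun i j =>
    if (i : ℕ) + 1 = p then -a.coeff j
    else if (j : ℕ) = (i : ℕ) + 1 then 1 else 0

/-- The last standard basis vector of `ℝ ^ p`. -/
def lastVec (p : ℕ) : Fin p → ℝ := fun i => if (i : ℕ) + 1 = p then 1 else 0

/-- `X` solves the state equation `dX = A X dt + e_p dL`; as the noise is additive, this is
the pathwise integral equation `X_t - X_s = ∫_s^t A X_u du + e_p (L_t - L_s)`. -/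
structure IsStateSolution (P : Measure Ω) (L : ℝ → Ω → ℝ) (p : ℕ) (a : ℝ[X])
    (X : ℝ → Ω → Fin p → ℝ) : Prop where
  measurable : ∀ t, Measurable (X t)
  intervalIntegrable : ∀ᵐ ω ∂P, ∀ (s t : ℝ) (i : Fin p),
    IntervalIntegrable (fun u => X u ω i) volume s t
  equation : ∀ᵐ ω ∂P, ∀ (s t : ℝ) (i : Fin p),
    X t ω i - X s ω i =
      (∫ u in s..t, (stateMatrix p a *ᵥ X u ω) i) + lastVec p i * (L t ω - L s ω)

/-- `Y` is a CARMA process with autoregressive polynomial `a` (of degree `p`), moving average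
polynomial `b` and driving process `L`: a strictly stationary process `Y_t = bᵀ X_t`, where `X`
solves the state equation. -/
def IsCARMA (P : Measure Ω) (L : ℝ → Ω → ℝ) (p : ℕ) (a b : ℝ[X]) (Y : ℝ → Ω → ℝ) : Prop :=
  IsStrictlyStationary P Y ∧
    ∃ X : ℝ → Ω → Fin p → ℝ, IsStateSolution P L p a X ∧
      ∀ t, ∀ᵐ ω ∂P, Y t ω = ∑ j : Fin p, b.coeff j * X t ω j

/-- The sampled sequence `Y^Δ = (Y_{nΔ})`. -/
def sampled (Y : ℝ → Ω → ℝ) (Δ : ℝ) (n : ℤ) (ω : Ω) : ℝ := Y (n * Δ) ω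

/-- The polynomial `∏ⱼ (1 - exp (λⱼ Δ) z)` over the complex zeroes of `a`, with multiplicity. -/
def filterPolyC (a : ℝ[X]) (Δ : ℝ) : ℂ[X] :=
  ((a.map (algebraMap ℝ ℂ)).roots.map fun l => 1 - C (Complex.exp (l * Δ)) * X).prod

/-- `filterPolyC` as a real polynomial; its coefficients are real, see `map_filterPoly`. -/
def filterPoly (a : ℝ[X]) (Δ : ℝ) : ℝ[X] :=
  ∑ k ∈ (filterPolyC a Δ).support, monomial k ((filterPolyC a Δ).coeff k).re

theorem filterPolyC_map_conj (a : ℝ[X]) (Δ : ℝ) :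
    (filterPolyC a Δ).map (starRingEnd ℂ) = filterPolyC a Δ := by
  have hr : (a.map (algebraMap ℝ ℂ)).roots.map (starRingEnd ℂ) =
      (a.map (algebraMap ℝ ℂ)).roots := by
    rw [← Polynomial.Splits.roots_map (IsAlgClosed.splits _), Polynomial.map_map]
    congr 2
    ext x
    simp
  unfold filterPolyC
  rw [Polynomial.map_multiset_prod, Multiset.map_map]
  conv_rhs => rw [← hr, Multiset.map_map]
  congr 1
  refine Multiset.map_congr rfl fun l _ => ?_
  simp [← Complex.exp_conj]

theorem map_filterPoly (a : ℝ[X]) (Δ : ℝ) :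
    (filterPoly a Δ).map (algebraMap ℝ ℂ) = filterPolyC a Δ := by
  ext k
  have h := congrArg (fun f => f.coeff k) (filterPolyC_map_conj a Δ)
  simp only [coeff_map] at h
  have h2 : (((filterPolyC a Δ).coeff k).re : ℂ) = (filterPolyC a Δ).coeff k :=
    Complex.conj_eq_iff_re.1 h
  have h3 : (filterPoly a Δ).coeff k = ((filterPolyC a Δ).coeff k).re := by
    simp only [filterPoly, finsetSum_coeff, coeff_monomial, Finset.sum_ite_eq', mem_support_iff]
    split_ifs with h0
    · rfl
    · simp [not_not.1 h0]
  rw [coeff_map, h3, ← h2]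
  simp

/-- The sequence `φ(B) U`, where `B` is the backward shift: `(φ(B) U)_n = ∑ₖ φₖ U_{n-k}`. -/
def applyFilter (φ : ℝ[X]) (U : ℤ → Ω → ℝ) (n : ℤ) (ω : Ω) : ℝ :=
  φ.sum fun k c => c * U (n - k) ω

/-- The filtered sampled sequence `φ(B) Y^Δ`. -/
def filtered (a : ℝ[X]) (Y : ℝ → Ω → ℝ) (Δ : ℝ) : ℤ → Ω → ℝ :=
  applyFilter (filterPoly a Δ) (sampled Y Δ)

/-- Zero-mean weakly stationary sequences. -/
structure IsWeaklyStationary (P : Measure Ω) (U : ℤ → Ω → ℝ) : Prop where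
  memLp_two : ∀ n, MemLp (U n) 2 P
  mean_zero : ∀ n, ∫ ω, U n ω ∂P = 0
  cov_shift : ∀ n h, cov[U (n + h), U n; P] = cov[U h, U 0; P]

/-- Autocovariance at lag `h` of a weakly stationary sequence. -/
def autocov (P : Measure Ω) (U : ℤ → Ω → ℝ) (h : ℤ) : ℝ := cov[U h, U 0; P]

/-- The spectral density `(2π)⁻¹ ∑_h γ(h) exp (-i h ω)` of a weakly stationary sequence with
summable autocovariances; the sum is real because `γ` is even. -/
def spectralDensity (P : Measure Ω) (U : ℤ → Ω → ℝ) (w : ℝ) : ℝ :=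
  (1 / (2 * Real.pi) *
    ∑' h : ℤ, (autocov P U h : ℂ) * Complex.exp (-(Complex.I * h * w))).re

/-- Uncorrelated zero-mean sequence with constant variance `v`. -/
structure IsWhiteNoise (P : Measure Ω) (v : ℝ) (Z : ℤ → Ω → ℝ) : Prop where
  memLp_two : ∀ n, MemLp (Z n) 2 P
  mean_zero : ∀ n, ∫ ω, Z n ω ∂P = 0
  variance : ∀ n, Var[Z n; P] = v
  uncorrelated : ∀ m n, m ≠ n → cov[Z m, Z n; P] = 0

/-- `φ(B) Y^Δ = θ(B) Z` with `θ(z) = 1 + θ₁ z + ⋯ + θ_{p-1} z ^ (p - 1)` and `Z` white noise of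
variance `v`. -/
structure IsARMARepresentation (P : Measure Ω) (p : ℕ) (a : ℝ[X]) (Y : ℝ → Ω → ℝ) (Δ : ℝ)
    (θ : ℝ[X]) (v : ℝ) (Z : ℤ → Ω → ℝ) : Prop where
  coeff_zero : θ.coeff 0 = 1
  degree : θ.natDegree < p
  whiteNoise : IsWhiteNoise P v Z
  equation : ∀ n, ∀ᵐ ω ∂P, filtered a Y Δ n ω = applyFilter θ Z n ω

/-- The coefficient of `x ^ (2 k + 1)` in the Taylor expansion at `0` of
`sinh x / (cosh x - cos w)`. -/
def c (k : ℕ) (w : ℝ) : ℝ :=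
  iteratedDeriv (2 * k + 1) (fun x : ℝ => Real.sinh x / (Real.cosh x - Real.cos w)) 0 /
    (2 * k + 1).factorial

end CARMA

end

/-!
Write `M = exp (Δ A)` and `N_i = ∑_{k ≤ i} φ_k M ^ (i - k)` (`horner`). The state satisfies
`X_n = M X_{n-1} + R_n` along the sampling grid, so filtering it leaves the initial term
`N_p X_{n-p}` and the noise terms `N_j R_{n-j}`, `j < p`. As `φ` is the reversed characteristic
polynomial of `M`, Cayley–Hamilton gives `N_p = 0` (`horner_filterPoly_eq_zero`). By variation of
constants (`dotProduct_solution_eq`), the filtered process is then a finite moving average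
`∑_{j < p} ∫ G_j dL` of Wiener integrals over consecutive blocks of length `Δ`, with kernels
`G_j x = bᵀ N_j exp (x A) e_p` (`isBlockMovingAverage_filtered`). The Wiener integrals are
defined pathwise by integration by parts, and the Itô isometry
(`IsSecondOrderLevy.integral_wienerIntegral_mul`) follows from Fubini and
`E (L_t - L_s)² = σ² |t - s|`. This gives weak stationarity, the vanishing of the autocovariances
from lag `p` on, and, with `z = exp (- i w)`,
`f_MA(w) = σ² / (2π) ∫₀^Δ |∑_j z ^ j G_j(x)|² dx` (`IsBlockMovingAverage.spectralDensity_eq`).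

The matrix polynomial `N(z) = ∑_j z ^ j N_j` satisfies `N(z) (1 - z M) = φ(z)`, so the transfer
function is `φ(z) bᵀ (1 - z exp (Δ A))⁻¹ exp (x A) e_p`. With `x = Δ y` and
`exp (s y) / (1 - z exp s) = ∑_k E_k(y) s ^ k` (the `E_k`, called `apostol`, are Apostol–Bernoulli
polynomials), the vanishing of `bᵀ A ^ k e_p` for `k < m = p - q - 1` and its value `1` for `k = m`
make it asymptotic to `(1 - z) ^ p Δ ^ m E_m(y)`, uniformly in `y`
(`norm_mul_exp_sub_apostol_le`, `tendsto_integral_normSq_resolvent`). There remains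
`∫₀¹ |E_m|² = (-1) ^ m c_m(w) / 2` (`integral_normSq_apostol`). Repeated integration by parts, with
boundary terms cancelling because `|z| = 1`, reduces the left side to `(-1) ^ (m + 1) E_{2m+1}(0)`,
and the identity `1 / (1 - z eˢ) + 1 / (1 - z̄ eˢ) - 1 = - sinh s / (cosh s - cos w)` identifies
`E_{2m+1}(0)`. As `E_m ≠ 0`, this also shows `c_m(w) ≠ 0`, so the ratio in the theorem is genuine.
-/

noncomputable section

namespace CARMA

/-! ### Taylor coefficients of `sinh x / (cosh x - cos w)` -/

/-- The function whose odd Taylor coefficients at `0` are the numbers `c k w`. -/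
def sinhKernel (w x : ℝ) : ℝ := Real.sinh x / (Real.cosh x - Real.cos w)

theorem cos_lt_one_of_mem_Icc {w : ℝ} (hw : w ∈ Set.Icc (-Real.pi) Real.pi) (h0 : w ≠ 0) :
    Real.cos w < 1 := by
  refine lt_of_le_of_ne (Real.cos_le_one w) fun h => h0 ?_
  refine (Real.cos_eq_one_iff_of_lt_of_lt ?_ ?_).1 h
  · linarith [hw.1, Real.pi_pos]
  · linarith [hw.2, Real.pi_pos]

theorem analyticAt_sinhKernel {w : ℝ} (hw : Real.cos w < 1) : AnalyticAt ℝ (sinhKernel w) 0 := by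
  have h1 : AnalyticAt ℝ Real.sinh 0 := Real.analyticAt_sinh
  have h2 : AnalyticAt ℝ (fun x => Real.cosh x - Real.cos w) 0 :=
    Real.analyticAt_cosh.sub analyticAt_const
  refine h1.div h2 ?_
  simp only [Real.cosh_zero]
  linarith

/-- The Taylor coefficients of `sinhKernel w` at `0`. -/
def kernelCoeff (w : ℝ) (n : ℕ) : ℝ := iteratedDeriv n (sinhKernel w) 0 / n.factorial

theorem kernelCoeff_odd (w : ℝ) (k : ℕ) : kernelCoeff w (2 * k + 1) = c k w := rfl

theorem kernelCoeff_even (w : ℝ) (k : ℕ) : kernelCoeff w (2 * k) = 0 := by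
  have h := iteratedDeriv_comp_neg (2 * k) (sinhKernel w) 0
  have h2 : (fun x => sinhKernel w (-x)) = -sinhKernel w := by
    ext x
    simp [sinhKernel, neg_div]
  rw [h2, iteratedDeriv_neg] at h
  simp only [neg_zero, Even.neg_pow (even_two_mul k), one_pow, one_smul] at h
  have : iteratedDeriv (2 * k) (sinhKernel w) 0 = 0 := by linarith
  simp [kernelCoeff, this]

theorem hasSum_c {w : ℝ} (hw : Real.cos w < 1) :
    ∀ᶠ x in 𝓝 (0 : ℝ), HasSum (fun k : ℕ => c k w * x ^ (2 * k + 1)) (sinhKernel w x) := by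
  have h := (analyticAt_sinhKernel hw).hasFPowerSeriesAt.eventually_hasSum
  filter_upwards [h] with x hx
  have hx' : HasSum (fun n => kernelCoeff w n * x ^ n) (sinhKernel w x) := by
    simpa [FormalMultilinearSeries.ofScalars_apply_eq, kernelCoeff, mul_comm] using hx
  have hinj : Function.Injective (fun k : ℕ => 2 * k + 1) := fun a b hab => by
    simpa using hab
  refine (hinj.hasSum_iff ?_).2 hx'
  intro n hn
  obtain ⟨k, rfl | rfl⟩ := n.even_or_odd'
  · simp [kernelCoeff_even]
  · exact absurd ⟨k, rfl⟩ hn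

theorem iteratedDeriv_sinh_zero (n : ℕ) :
    iteratedDeriv n Real.sinh 0 = if Even n then 0 else 1 := by
  obtain ⟨k, rfl | rfl⟩ := n.even_or_odd'
  · simp
  · simp

theorem iteratedDeriv_cosh_sub_const_zero (v : ℝ) (n : ℕ) :
    iteratedDeriv n (fun x => Real.cosh x - v) 0 =
      (if Even n then 1 else 0) - (if n = 0 then v else 0) := by
  rcases n with _ | n
  · simp
  · have h : deriv (fun x => Real.cosh x - v) = deriv Real.cosh := by
      ext x
      exact deriv_sub_const v
    rw [iteratedDeriv_succ', h, ← iteratedDeriv_succ']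
    obtain ⟨k, hk | hk⟩ := (n + 1).even_or_odd'
    · rw [if_neg n.succ_ne_zero, hk]
      simp
    · rw [if_neg n.succ_ne_zero, hk]
      simp

/-- Leibniz' rule applied to `(cosh x - cos w) * sinhKernel w x = sinh x`. -/
theorem sum_choose_mul_iteratedDeriv {w : ℝ} (hw : Real.cos w < 1) (n : ℕ) :
    ∑ i ∈ Finset.range (n + 1), (n.choose i : ℝ) *
      ((if Even i then 1 else 0) - (if i = 0 then Real.cos w else 0)) *
        iteratedDeriv (n - i) (sinhKernel w) 0 = if Even n then 0 else 1 := by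
  have h1 : ContDiffAt ℝ n (fun x => Real.cosh x - Real.cos w) 0 :=
    (Real.contDiff_cosh.sub contDiff_const).contDiffAt
  have h2 : ContDiffAt ℝ n (sinhKernel w) 0 := (analyticAt_sinhKernel hw).contDiffAt
  have h3 : (fun x => Real.cosh x - Real.cos w) * sinhKernel w = Real.sinh := by
    ext x
    have : Real.cosh x - Real.cos w ≠ 0 := by linarith [Real.one_le_cosh x]
    simp only [Pi.mul_apply, sinhKernel]
    field_simp
  have h := iteratedDeriv_mul h1 h2
  rw [h3, iteratedDeriv_sinh_zero] at h
  rw [h]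
  refine Finset.sum_congr rfl fun i _ => ?_
  rw [iteratedDeriv_cosh_sub_const_zero]

theorem c_zero_one_two {w : ℝ} (hw : Real.cos w < 1) :
    c 0 w = 1 / (1 - Real.cos w) ∧
      c 1 w = -((2 + Real.cos w) / (6 * (1 - Real.cos w) ^ 2)) ∧
      c 2 w = (33 + 26 * Real.cos w + Real.cos (2 * w)) / (240 * (1 - Real.cos w) ^ 3) := by
  have hne : 1 - Real.cos w ≠ 0 := by linarith
  have e0 := kernelCoeff_even w 0
  have e1 := kernelCoeff_even w 1
  have e2 := kernelCoeff_even w 2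
  have h1 := sum_choose_mul_iteratedDeriv hw 1
  have h3 := sum_choose_mul_iteratedDeriv hw 3
  have h5 := sum_choose_mul_iteratedDeriv hw 5
  have k0 := kernelCoeff_odd w 0
  have k1 := kernelCoeff_odd w 1
  have k2 := kernelCoeff_odd w 2
  simp only [kernelCoeff, mul_zero, mul_one, Nat.factorial, zero_add, Nat.reduceMul, Nat.reduceAdd]
    at e0 e1 e2 k0 k1 k2
  norm_num [Finset.sum_range_succ, Nat.choose, show ¬ Even 3 by decide, show ¬ Even 5 by decide,
    show Even 4 by decide, -iteratedDeriv_zero, -iteratedDeriv_one]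
    at h1 h3 h5 e0 e1 e2 k0 k1 k2
  rw [Real.cos_two_mul, ← k0, ← k1, ← k2]
  generalize iteratedDeriv 1 (sinhKernel w) 0 = f1 at *
  generalize iteratedDeriv 3 (sinhKernel w) 0 = f3 at *
  generalize iteratedDeriv 5 (sinhKernel w) 0 = f5 at *
  have g1 : f1 = 1 / (1 - Real.cos w) := by
    field_simp; linarith
  have g3 : f3 = (1 - 3 * f1) / (1 - Real.cos w) := by
    field_simp; linarith
  have g5 : f5 = (1 - 5 * f1 - 10 * f3) / (1 - Real.cos w) := by
    field_simp; linarith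
  refine ⟨g1, ?_, ?_⟩
  · rw [g3, g1]; field_simp; ring
  · rw [g5, g3, g1]; field_simp; ring

/-! ### Apostol–Bernoulli polynomials -/

/-- The formal power series `1 / (1 - z exp X)`. -/
def apostolSeries (z : ℂ) : PowerSeries ℂ :=
  (1 - PowerSeries.C z * PowerSeries.exp ℂ)⁻¹

theorem one_sub_mul_apostolSeries {z : ℂ} (hz : z ≠ 1) :
    (1 - PowerSeries.C z * PowerSeries.exp ℂ) * apostolSeries z = 1 := by
  refine PowerSeries.mul_inv_cancel _ ?_
  simpa [sub_eq_zero] using hz.symm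

/-- The coefficient of `s ^ k` in `exp (s y) / (1 - z exp s)`, a polynomial of degree `k` in `y`
(an Apostol–Bernoulli polynomial up to normalisation). -/
def apostol (z : ℂ) (k : ℕ) (y : ℝ) : ℂ :=
  ∑ j ∈ Finset.range (k + 1), PowerSeries.coeff (k - j) (apostolSeries z) * (y ^ j / j.factorial)

theorem apostol_apply_zero (z : ℂ) (k : ℕ) :
    apostol z k 0 = PowerSeries.coeff k (apostolSeries z) := by
  rw [apostol, Finset.sum_eq_single 0]
  · simp
  · intro j _ hj
    simp [hj]
  · simp

theorem apostol_boundary {z : ℂ} (hz : z ≠ 1) (k : ℕ) :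
    apostol z k 0 - z * apostol z k 1 = if k = 0 then 1 else 0 := by
  have h := congrArg (PowerSeries.coeff k) (one_sub_mul_apostolSeries hz)
  rw [sub_mul, one_mul, map_sub, mul_assoc, PowerSeries.coeff_C_mul, PowerSeries.coeff_one,
    PowerSeries.coeff_mul, Finset.Nat.sum_antidiagonal_eq_sum_range_succ_mk] at h
  rw [apostol_apply_zero, ← h, apostol]
  congr 2
  refine Finset.sum_congr rfl fun j _ => ?_
  simp [PowerSeries.coeff_exp]
  ring

theorem apostol_zero {z : ℂ} (hz : z ≠ 1) (y : ℝ) : apostol z 0 y = (1 - z)⁻¹ := by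
  have h := apostol_boundary hz 0
  have h1 : ∀ y, apostol z 0 y = PowerSeries.coeff 0 (apostolSeries z) := fun y => by
    simp [apostol]
  rw [h1, h1] at h
  rw [h1]
  have h2 : 1 - z ≠ 0 := sub_ne_zero.2 hz.symm
  field_simp
  simp only [if_true] at h
  linear_combination h

theorem hasDerivAt_apostol_succ (z : ℂ) (k : ℕ) (y : ℝ) :
    HasDerivAt (apostol z (k + 1)) (apostol z k y) y := by
  have h1 : apostol z (k + 1) = fun y : ℝ => ∑ j ∈ Finset.range (k + 1),
      PowerSeries.coeff (k - j) (apostolSeries z) * ((y : ℂ) ^ (j + 1) / (j + 1).factorial) +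
      PowerSeries.coeff (k + 1) (apostolSeries z) := by
    ext y
    rw [apostol, Finset.sum_range_succ']
    simp
  rw [h1, apostol]
  refine HasDerivAt.add_const _ (HasDerivAt.fun_sum fun j _ => HasDerivAt.const_mul _ ?_)
  have h2 := ((hasDerivAt_pow (j + 1) (y : ℂ)).comp_ofReal).div_const ((j + 1).factorial : ℂ)
  refine h2.congr_deriv ?_
  have : ((j : ℂ) + 1) ≠ 0 := by exact_mod_cast j.succ_ne_zero
  have : (j.factorial : ℂ) ≠ 0 := by exact_mod_cast j.factorial_ne_zero
  rw [Nat.factorial_succ]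
  push_cast
  field_simp

theorem continuous_apostol (z : ℂ) (k : ℕ) : Continuous (apostol z k) := by
  unfold apostol
  fun_prop

theorem hasDerivAt_apostol_zero (z : ℂ) (y : ℝ) : HasDerivAt (apostol z 0) 0 y := by
  have h1 : apostol z 0 = fun _ => PowerSeries.coeff 0 (apostolSeries z) := by
    ext y; simp [apostol]
  rw [h1]
  exact hasDerivAt_const _ _

/-- Integration by parts; on the unit circle the boundary terms cancel. -/
theorem integral_apostol_mul_conj_succ {z : ℂ} (hz : z ≠ 1) (hz1 : ‖z‖ = 1) (j k : ℕ) :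
    ∫ y in (0 : ℝ)..1, apostol z j y * (starRingEnd ℂ) (apostol z (k + 1) y) =
      -∫ y in (0 : ℝ)..1, apostol z (j + 1) y * (starRingEnd ℂ) (apostol z k y) := by
  have h := intervalIntegral.integral_mul_deriv_eq_deriv_mul (a := 0) (b := 1)
    (u := fun y => (starRingEnd ℂ) (apostol z (k + 1) y))
    (u' := fun y => (starRingEnd ℂ) (apostol z k y))
    (v := apostol z (j + 1)) (v' := apostol z j)
    (fun y _ => (hasDerivAt_apostol_succ z k y).star)
    (fun y _ => hasDerivAt_apostol_succ z j y)
    ((Complex.continuous_conj.comp (continuous_apostol z k)).intervalIntegrable _ _)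
    ((continuous_apostol z j).intervalIntegrable _ _)
  have hj := apostol_boundary hz (j + 1)
  have hk := apostol_boundary hz (k + 1)
  rw [if_neg (Nat.succ_ne_zero _), sub_eq_zero] at hj hk
  have hzz : z * (starRingEnd ℂ) z = 1 := by
    rw [Complex.mul_conj, Complex.normSq_eq_norm_sq, hz1]; simp
  have hb : (starRingEnd ℂ) (apostol z (k + 1) 1) * apostol z (j + 1) 1 -
      (starRingEnd ℂ) (apostol z (k + 1) 0) * apostol z (j + 1) 0 = 0 := by
    rw [hj, hk, map_mul]
    linear_combination
      -(starRingEnd ℂ) (apostol z (k + 1) 1) * apostol z (j + 1) 1 * hzz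
  rw [hb, zero_sub] at h
  simp_rw [mul_comm _ ((starRingEnd ℂ) _)]
  exact h

theorem integral_apostol_mul_conj {z : ℂ} (hz : z ≠ 1) (hz1 : ‖z‖ = 1) (j k : ℕ) :
    ∫ y in (0 : ℝ)..1, apostol z j y * (starRingEnd ℂ) (apostol z k y) =
      (-1) ^ k * ∫ y in (0 : ℝ)..1, apostol z (j + k) y * (starRingEnd ℂ) (apostol z 0 y) := by
  induction k generalizing j with
  | zero => simp
  | succ k ih =>
    rw [integral_apostol_mul_conj_succ hz hz1, ih, show j + 1 + k = j + (k + 1) by ring]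
    ring

theorem integral_apostol_mul_conj_self {z : ℂ} (hz : z ≠ 1) (hz1 : ‖z‖ = 1) (m : ℕ) :
    ∫ y in (0 : ℝ)..1, apostol z m y * (starRingEnd ℂ) (apostol z m y) =
      (-1) ^ (m + 1) * PowerSeries.coeff (2 * m + 1) (apostolSeries z) := by
  rw [integral_apostol_mul_conj hz hz1, ← two_mul]
  simp_rw [apostol_zero hz]
  rw [intervalIntegral.integral_mul_const,
    intervalIntegral.integral_eq_sub_of_hasDerivAt
      (fun y _ => hasDerivAt_apostol_succ z (2 * m) y)
      ((continuous_apostol z (2 * m)).intervalIntegrable _ _), ← apostol_apply_zero]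
  have h := apostol_boundary hz (2 * m + 1)
  rw [if_neg (Nat.succ_ne_zero _), sub_eq_zero] at h
  have hzz : z * (starRingEnd ℂ) z = 1 := by
    rw [Complex.mul_conj, Complex.normSq_eq_norm_sq, hz1]; simp
  have h2 : 1 - (starRingEnd ℂ) z ≠ 0 := by
    intro h0
    apply hz
    have := congrArg (starRingEnd ℂ) (sub_eq_zero.1 h0)
    simpa using this.symm
  rw [map_inv₀, map_sub, map_one]
  field_simp
  rw [h, pow_succ]
  linear_combination -(-1) ^ m * apostol z (2 * m + 1) 1 * hzz

theorem apostol_ne_zero {z : ℂ} (hz : z ≠ 1) (m : ℕ) :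
    ¬ ∀ y ∈ Set.Ioo (0 : ℝ) 1, apostol z m y = 0 := by
  induction m with
  | zero =>
    intro h
    have h1 := h (1 / 2) (by norm_num)
    rw [apostol_zero hz, inv_eq_zero, sub_eq_zero] at h1
    exact hz h1.symm
  | succ m ih =>
    intro h
    refine ih fun y hy => ?_
    have h1 : apostol z (m + 1) =ᶠ[𝓝 y] fun _ => 0 := by
      filter_upwards [isOpen_Ioo.mem_nhds hy] with x hx using h x hx
    exact (hasDerivAt_apostol_succ z m y).unique ((hasDerivAt_const y 0).congr_of_eventuallyEq h1)

theorem integral_normSq_apostol_pos {z : ℂ} (hz : z ≠ 1) (m : ℕ) :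
    0 < ∫ y in (0 : ℝ)..1, Complex.normSq (apostol z m y) := by
  have hc : Continuous fun y => Complex.normSq (apostol z m y) :=
    Complex.continuous_normSq.comp (continuous_apostol z m)
  have h := apostol_ne_zero hz m
  push Not at h
  obtain ⟨y, hy, hne⟩ := h
  exact intervalIntegral.integral_pos zero_lt_one hc.continuousOn
    (fun _ _ => Complex.normSq_nonneg _) ⟨y, Set.Ioo_subset_Icc_self hy, Complex.normSq_pos.2 hne⟩

/-! ### The constant of the asymptotic law -/

/-- The Taylor series of `sinhKernel w` at `0`, as a formal power series. -/
def kernelSeries (w : ℝ) : PowerSeries ℂ := PowerSeries.mk fun n => (kernelCoeff w n : ℂ)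

theorem kernelSeries_mul {w : ℝ} (hw : Real.cos w < 1) :
    (PowerSeries.exp ℂ + PowerSeries.evalNegHom (PowerSeries.exp ℂ) -
      PowerSeries.C (2 * (Real.cos w : ℂ))) * kernelSeries w =
      PowerSeries.exp ℂ - PowerSeries.evalNegHom (PowerSeries.exp ℂ) := by
  ext n
  have h := congrArg (fun x : ℝ => (x : ℂ)) (sum_choose_mul_iteratedDeriv hw n)
  have hn : (n.factorial : ℂ) ≠ 0 := by exact_mod_cast n.factorial_ne_zero
  rw [PowerSeries.coeff_mul, Finset.Nat.sum_antidiagonal_eq_sum_range_succ_mk]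
  have h2 : PowerSeries.coeff n
      (PowerSeries.exp ℂ - PowerSeries.evalNegHom (PowerSeries.exp ℂ)) =
        2 / n.factorial * (((if Even n then 0 else 1 : ℝ) : ℂ)) := by
    rw [map_sub, PowerSeries.evalNegHom, PowerSeries.coeff_rescale, PowerSeries.coeff_exp]
    split_ifs with hn
    · simp [hn.neg_one_pow]
    · simp [(Nat.not_even_iff_odd.1 hn).neg_one_pow]
      ring
  rw [h2, ← h, Complex.ofReal_sum, Finset.mul_sum]
  refine Finset.sum_congr rfl fun i hi => ?_
  have hi' : i ≤ n := Nat.lt_succ_iff.1 (Finset.mem_range.1 hi)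
  have e1 : (i.factorial : ℂ) ≠ 0 := by exact_mod_cast i.factorial_ne_zero
  have e2 : ((n - i).factorial : ℂ) ≠ 0 := by exact_mod_cast (n - i).factorial_ne_zero
  have h3 : PowerSeries.coeff i (PowerSeries.exp ℂ +
      PowerSeries.evalNegHom (PowerSeries.exp ℂ) - PowerSeries.C (2 * (Real.cos w : ℂ))) =
        2 / i.factorial * ((((if Even i then 1 else 0 : ℝ) - (if i = 0 then Real.cos w else 0) : ℝ)
          : ℂ)) := by
    rw [map_sub, map_add, PowerSeries.evalNegHom, PowerSeries.coeff_rescale,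
      PowerSeries.coeff_exp, PowerSeries.coeff_C]
    rcases Nat.eq_zero_or_pos i with rfl | hpos
    · simp
      ring
    · by_cases hev : Even i
      · simp [hev.neg_one_pow, hev, hpos.ne']
        ring
      · simp [(Nat.not_even_iff_odd.1 hev).neg_one_pow, hev, hpos.ne']
  have h4 : ((n.choose i : ℕ) : ℂ) = n.factorial / (i.factorial * (n - i).factorial) := by
    rw [Nat.choose_eq_factorial_div_factorial hi', Nat.cast_div_charZero
      (Nat.factorial_mul_factorial_dvd_factorial hi')]
    push_cast
    rfl
  rw [h3, Complex.ofReal_mul, Complex.ofReal_mul, Complex.ofReal_natCast, h4, kernelSeries,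
    PowerSeries.coeff_mk, kernelCoeff]
  push_cast
  field_simp

/-- In terms of functions, this is
`1 / (1 - z eˣ) + 1 / (1 - z̄ eˣ) - 1 = - sinh x / (cosh x - cos w)` for `z = exp (± i w)`. -/
theorem apostolSeries_add_conj {z : ℂ} {w : ℝ} (hw : Real.cos w < 1) (hz1 : ‖z‖ = 1)
    (hzw : z.re = Real.cos w) :
    apostolSeries z + apostolSeries ((starRingEnd ℂ) z) - 1 = -kernelSeries w := by
  have hz : z ≠ 1 := by
    rintro rfl
    simp at hzw
    linarith
  have hz' : (starRingEnd ℂ) z ≠ 1 := by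
    intro h
    have := congrArg Complex.re h
    simp at this
    linarith
  have h1 := one_sub_mul_apostolSeries hz
  have h2 := one_sub_mul_apostolSeries hz'
  have h3 := kernelSeries_mul hw
  have h4 := PowerSeries.exp_mul_exp_neg_eq_one (A := ℂ)
  have h5 : PowerSeries.C z * PowerSeries.C ((starRingEnd ℂ) z) = (1 : PowerSeries ℂ) := by
    rw [← map_mul, Complex.mul_conj, Complex.normSq_eq_norm_sq, hz1]; simp
  have h6 : PowerSeries.C z + PowerSeries.C ((starRingEnd ℂ) z) =
      PowerSeries.C (2 * (Real.cos w : ℂ)) := by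
    rw [← map_add, Complex.add_conj, hzw]; simp
  have hU : (1 - PowerSeries.C z * PowerSeries.exp ℂ) *
      (1 - PowerSeries.C ((starRingEnd ℂ) z) * PowerSeries.exp ℂ) ≠ 0 :=
    mul_ne_zero (left_ne_zero_of_mul_eq_one h1) (left_ne_zero_of_mul_eq_one h2)
  refine mul_left_cancel₀ hU ?_
  rw [← h6] at h3
  generalize apostolSeries z = e at *
  generalize apostolSeries ((starRingEnd ℂ) z) = e' at *
  generalize PowerSeries.evalNegHom (PowerSeries.exp ℂ) = E' at *
  generalize PowerSeries.exp ℂ = E at *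
  generalize PowerSeries.C z = Z at *
  generalize PowerSeries.C ((starRingEnd ℂ) z) = Z' at *
  generalize kernelSeries w = F at *
  linear_combination (1 - Z' * E) * h1 + (1 - Z * E) * h2 + E * h3 - (F + 1) * h4 +
    (E ^ 2 * F - E ^ 2) * h5

theorem conj_coeff_apostolSeries {z : ℂ} (hz : z ≠ 1) (n : ℕ) :
    PowerSeries.coeff n (apostolSeries ((starRingEnd ℂ) z)) =
      (starRingEnd ℂ) (PowerSeries.coeff n (apostolSeries z)) := by
  have hz' : (starRingEnd ℂ) z ≠ 1 := by
    intro h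
    apply hz
    simpa using congrArg (starRingEnd ℂ) h
  have h1 := congrArg (PowerSeries.map (starRingEnd ℂ)) (one_sub_mul_apostolSeries hz)
  simp only [map_mul, map_sub, map_one, PowerSeries.map_C, PowerSeries.map_exp] at h1
  have h2 := one_sub_mul_apostolSeries hz'
  have h3 : apostolSeries ((starRingEnd ℂ) z) =
      PowerSeries.map (starRingEnd ℂ) (apostolSeries z) :=
    mul_left_cancel₀ (left_ne_zero_of_mul_eq_one h2) (h2.trans h1.symm)
  rw [h3, PowerSeries.coeff_map]

theorem integral_normSq_apostol {z : ℂ} {w : ℝ} (hw : Real.cos w < 1) (hz1 : ‖z‖ = 1)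
    (hzw : z.re = Real.cos w) (m : ℕ) :
    ∫ y in (0 : ℝ)..1, Complex.normSq (apostol z m y) = (-1) ^ m * c m w / 2 := by
  have hz : z ≠ 1 := by
    rintro rfl
    simp at hzw
    linarith
  have h1 := integral_apostol_mul_conj_self hz hz1 m
  have h2 := congrArg (PowerSeries.coeff (2 * m + 1)) (apostolSeries_add_conj hw hz1 hzw)
  rw [map_sub, map_add, conj_coeff_apostolSeries hz, Complex.add_conj, PowerSeries.coeff_one,
    if_neg (Nat.succ_ne_zero _), map_neg, kernelSeries, PowerSeries.coeff_mk, kernelCoeff_odd,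
    sub_zero] at h2
  have h3 : 2 * (PowerSeries.coeff (2 * m + 1) (apostolSeries z)).re = -c m w := by
    exact_mod_cast h2
  simp_rw [Complex.mul_conj] at h1
  rw [intervalIntegral.integral_ofReal] at h1
  have h4 := congrArg Complex.re h1
  rw [Complex.ofReal_re, show ((-1 : ℂ) ^ (m + 1)) = (((-1 : ℝ) ^ (m + 1) : ℝ) : ℂ) by simp,
    Complex.re_ofReal_mul] at h4
  rw [h4, pow_succ]
  linear_combination -(-1) ^ m / 2 * h3

/-! ### Asymptotics of resolvents of small exponentials -/

section BanachAlgebra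

variable {𝔸 : Type*} [NormedRing 𝔸] [NormedAlgebra ℂ 𝔸] [CompleteSpace 𝔸]

/-- `exp (y s) = (1 - z exp s) ∑_k E_k(y) s ^ k`, truncated after `s ^ m`, in a Banach algebra and
multiplied from the left by `N`. The difference `W` of the two sides satisfies
`W' = W s + φ E_m(y) s ^ (m + 1)` and `W 0 = z W 1`; as `z ≠ 1`, these bound `W` on `[0, 1]`
in terms of `W'`, hence in terms of the inhomogeneity alone if `s` is small. -/
theorem norm_mul_exp_sub_apostol_le {z : ℂ} (hz : z ≠ 1) (m : ℕ) {B K : ℝ}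
    (hB : ∀ y ∈ Set.Icc (0 : ℝ) 1, ‖apostol z m y‖ ≤ B) (hK : K = ‖(1 - z)⁻¹‖ + 1)
    {N s : 𝔸} {φ : ℂ} (hN : N * (1 - z • NormedSpace.exp s) = φ • (1 : 𝔸))
    (hs : K * ‖s‖ ≤ 1 / 2) {y : ℝ} (hy : y ∈ Set.Icc (0 : ℝ) 1) :
    ‖N * NormedSpace.exp ((y : ℂ) • s) -
      φ • ∑ k ∈ Finset.range (m + 1), apostol z k y • s ^ k‖ ≤
        2 * K * (‖φ‖ * B * ‖s ^ (m + 1)‖) := by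
  set W : ℝ → 𝔸 := fun y => N * NormedSpace.exp ((y : ℂ) • s) -
      φ • ∑ k ∈ Finset.range (m + 1), apostol z k y • s ^ k with hW
  have hderiv : ∀ y, HasDerivAt W (W y * s + (φ * apostol z m y) • s ^ (m + 1)) y := by
    intro y
    have h1 : HasDerivAt (fun y : ℝ => N * NormedSpace.exp ((y : ℂ) • s))
        (N * (NormedSpace.exp ((y : ℂ) • s) * s)) y := by
      have h := (hasDerivAt_exp_smul_const s (y : ℂ)).scomp y Complex.ofRealCLM.hasDerivAt
      simp only [Complex.ofRealCLM_apply, Complex.ofReal_one, one_smul] at h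
      exact h.const_mul N
    have h2 : HasDerivAt (fun y : ℝ => ∑ k ∈ Finset.range (m + 1), apostol z k y • s ^ k)
        (∑ k ∈ Finset.range m, apostol z k y • s ^ (k + 1)) y := by
      have h3 : ∀ k ∈ Finset.range m, HasDerivAt (fun y : ℝ => apostol z (k + 1) y • s ^ (k + 1))
          (apostol z k y • s ^ (k + 1)) y := fun k _ =>
        (hasDerivAt_apostol_succ z k y).smul_const _
      have h4 : HasDerivAt (fun y : ℝ => apostol z 0 y • s ^ 0) 0 y := by
        simpa only [zero_smul] using (hasDerivAt_apostol_zero z y).smul_const (s ^ 0)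
      have h5 := (HasDerivAt.fun_sum h3).add h4
      rw [add_zero] at h5
      refine h5.congr_of_eventuallyEq (Eventually.of_forall fun y => ?_)
      exact Finset.sum_range_succ' (fun k => apostol z k y • s ^ k) m
    refine (h1.sub (h2.const_smul φ)).congr_deriv ?_
    simp only [hW, sub_mul, smul_mul_assoc, Finset.sum_mul]
    rw [Finset.sum_range_succ, smul_add]
    simp only [← pow_succ, mul_smul, mul_assoc]
    abel
  have hbd : W 0 = z • W 1 := by
    have h1 : ∑ k ∈ Finset.range (m + 1), apostol z k 0 • s ^ k -
        z • ∑ k ∈ Finset.range (m + 1), apostol z k 1 • s ^ k = 1 := by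
      rw [Finset.smul_sum, ← Finset.sum_sub_distrib, Finset.sum_eq_single 0]
      · rw [smul_smul, ← sub_smul, apostol_boundary hz]
        simp
      · intro k _ hk
        rw [smul_smul, ← sub_smul, apostol_boundary hz, if_neg hk, zero_smul]
      · simp
    have h2 : W 0 - z • W 1 = 0 := by
      simp only [hW, Complex.ofReal_zero, zero_smul, NormedSpace.exp_zero, mul_one,
        Complex.ofReal_one, one_smul]
      rw [mul_sub, mul_one, mul_smul_comm] at hN
      rw [smul_sub, smul_comm z φ, sub_sub_sub_comm, hN, ← smul_sub, h1, sub_self]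
    exact sub_eq_zero.1 h2
  have hcont : Continuous W := continuous_iff_continuousAt.2 fun y => (hderiv y).continuousAt
  obtain ⟨y₀, hy₀, hmax⟩ := isCompact_Icc.exists_isMaxOn (Set.nonempty_Icc.2 zero_le_one)
    hcont.norm.continuousOn
  set S := ‖W y₀‖ with hS
  have hle : ∀ y ∈ Set.Icc (0 : ℝ) 1, ‖W y‖ ≤ S := fun y hy => hmax hy
  set ε := ‖φ‖ * B * ‖s ^ (m + 1)‖ with hε
  have hW' : ∀ y ∈ Set.Icc (0 : ℝ) 1,
      ‖W y * s + (φ * apostol z m y) • s ^ (m + 1)‖ ≤ ‖s‖ * S + ε := by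
    intro y hy
    refine (norm_add_le _ _).trans (add_le_add ?_ ?_)
    · refine (norm_mul_le _ _).trans ?_
      rw [mul_comm]
      exact mul_le_mul_of_nonneg_left (hle y hy) (norm_nonneg _)
    · rw [norm_smul, norm_mul]
      exact mul_le_mul_of_nonneg_right (mul_le_mul_of_nonneg_left (hB y hy) (norm_nonneg _))
        (norm_nonneg _)
  have hmv : ∀ y ∈ Set.Icc (0 : ℝ) 1, ‖W y - W 0‖ ≤ ‖s‖ * S + ε := by
    intro y hy
    have h0 : 0 ≤ ‖s‖ * S + ε := (norm_nonneg _).trans (hW' y hy)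
    have h := norm_image_sub_le_of_norm_deriv_le_segment'
      (fun x _ => (hderiv x).hasDerivWithinAt) (fun x hx => hW' x ⟨hx.1, hx.2.le⟩) y hy
    refine h.trans ?_
    rw [sub_zero]
    nlinarith [hy.2]
  have hz1 : 1 - z ≠ 0 := sub_ne_zero.2 hz.symm
  have h1z : (1 - z) • W 1 = W 1 - W 0 := by
    rw [hbd, sub_smul, one_smul]
  have h1 : ‖W 1‖ ≤ ‖(1 - z)⁻¹‖ * (‖s‖ * S + ε) := by
    have : W 1 = (1 - z)⁻¹ • (W 1 - W 0) := by
      rw [← h1z, smul_smul, inv_mul_cancel₀ hz1, one_smul]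
    rw [this, norm_smul]
    exact mul_le_mul_of_nonneg_left (hmv 1 ⟨zero_le_one, le_rfl⟩) (norm_nonneg _)
  have hmv1 : ‖W y₀ - W 1‖ ≤ ‖s‖ * S + ε := by
    have h0 : 0 ≤ ‖s‖ * S + ε := (norm_nonneg _).trans (hW' 0 ⟨le_rfl, zero_le_one⟩)
    have h := Convex.norm_image_sub_le_of_norm_hasDerivWithin_le
      (fun x _ => (hderiv x).hasDerivWithinAt) hW' (convex_Icc 0 1)
      (⟨zero_le_one, le_rfl⟩ : (1 : ℝ) ∈ Set.Icc (0 : ℝ) 1) hy₀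
    refine h.trans ?_
    have : ‖y₀ - 1‖ ≤ 1 := by
      rw [Real.norm_eq_abs, abs_le]
      constructor <;> linarith [hy₀.1, hy₀.2]
    nlinarith
  have hS1 : S ≤ K * (‖s‖ * S + ε) := by
    have h2 : ‖W y₀‖ ≤ ‖W y₀ - W 1‖ + ‖W 1‖ := by
      simpa using norm_add_le (W y₀ - W 1) (W 1)
    rw [hK]
    linarith
  have hSnn : 0 ≤ S := norm_nonneg _
  have h3 : K * ‖s‖ * S ≤ 1 / 2 * S := mul_le_mul_of_nonneg_right hs hSnn
  refine (hle y hy).trans ?_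
  linarith

/-- If `ℓ (A ^ m)` is the first nonvanishing moment of `A` and `N = φ (1 - z exp (Δ A))⁻¹`, then
`ℓ (N exp (x A))` is of order `Δ ^ m` for `0 ≤ x ≤ Δ`, with an Apostol–Bernoulli polynomial in
`x / Δ` as its profile. -/
theorem tendsto_integral_normSq_resolvent {z : ℂ} (hz : z ≠ 1) (m : ℕ) (A : 𝔸) (l : 𝔸 →L[ℂ] ℂ)
    (hl0 : ∀ k < m, l (A ^ k) = 0) (hlm : l (A ^ m) = 1) {N : ℝ → 𝔸} {φ : ℝ → ℂ} {φ₀ : ℂ}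
    (hN : ∀ Δ : ℝ, 0 < Δ →
      N Δ * (1 - z • NormedSpace.exp ((Δ : ℂ) • A)) = φ Δ • (1 : 𝔸))
    (hφ : Tendsto φ (𝓝[>] 0) (𝓝 φ₀)) :
    Tendsto (fun Δ : ℝ => (Δ ^ (2 * m + 1))⁻¹ *
        ∫ x in (0 : ℝ)..Δ, Complex.normSq (l (N Δ * NormedSpace.exp ((x : ℂ) • A))))
      (𝓝[>] 0) (𝓝 (∫ y in (0 : ℝ)..1, Complex.normSq (φ₀ * apostol z m y))) := by
  obtain ⟨B, hB⟩ := isCompact_Icc.exists_bound_of_continuousOn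
    (continuous_apostol z m).continuousOn (s := Set.Icc (0 : ℝ) 1)
  have hB0 : 0 ≤ B := (norm_nonneg _).trans (hB 0 ⟨le_rfl, zero_le_one⟩)
  set K : ℝ := ‖(1 - z)⁻¹‖ + 1 with hK
  have hK0 : 0 < K := by positivity
  set g : ℝ → ℝ → ℂ := fun Δ y =>
    ((Δ : ℂ) ^ m)⁻¹ * l (N Δ * NormedSpace.exp (((Δ * y : ℝ) : ℂ) • A)) with hg
  have hscale : ∀ Δ : ℝ, 0 < Δ → (Δ ^ (2 * m + 1))⁻¹ *
      ∫ x in (0 : ℝ)..Δ, Complex.normSq (l (N Δ * NormedSpace.exp ((x : ℂ) • A))) =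
        ∫ y in (0 : ℝ)..1, Complex.normSq (g Δ y) := by
    intro Δ hΔ
    have h := intervalIntegral.mul_integral_comp_mul_left (a := 0) (b := 1)
      (f := fun x : ℝ => Complex.normSq (l (N Δ * NormedSpace.exp ((x : ℂ) • A)))) Δ
    rw [mul_zero, mul_one] at h
    rw [← h, ← mul_assoc, ← intervalIntegral.integral_const_mul]
    refine intervalIntegral.integral_congr fun y _ => ?_
    have e : Complex.normSq ((Δ : ℂ) ^ m)⁻¹ = (Δ ^ (2 * m))⁻¹ := by
      rw [Complex.normSq_inv, Complex.normSq_eq_norm_sq, norm_pow, Complex.norm_real,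
        Real.norm_eq_abs, ← pow_mul, mul_comm m 2, Even.pow_abs (even_two_mul m)]
    simp only [hg, map_mul, e]
    field_simp
    ring
  -- the uniform remainder estimate, rescaled
  set R : ℝ → ℝ := fun Δ => ‖l‖ * (2 * K * (‖φ Δ‖ * B * ‖A ^ (m + 1)‖)) * Δ with hR
  have hsmall : ∀ᶠ Δ : ℝ in 𝓝[>] 0, K * ‖(Δ : ℂ) • A‖ ≤ 1 / 2 := by
    have h : Tendsto (fun Δ : ℝ => K * ‖(Δ : ℂ) • A‖) (𝓝 0) (𝓝 (K * ‖((0 : ℝ) : ℂ) • A‖)) :=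
      Continuous.tendsto (by fun_prop) 0
    simp only [Complex.ofReal_zero, zero_smul, norm_zero, mul_zero] at h
    exact (h.mono_left nhdsWithin_le_nhds).eventually (eventually_le_nhds (by norm_num))
  have hrem : ∀ᶠ Δ : ℝ in 𝓝[>] 0, ∀ y ∈ Set.Icc (0 : ℝ) 1,
      ‖g Δ y - φ Δ * apostol z m y‖ ≤ R Δ := by
    filter_upwards [hsmall, self_mem_nhdsWithin] with Δ hs (hΔ : 0 < Δ) y hy
    have h := norm_mul_exp_sub_apostol_le hz m hB hK (hN Δ hΔ) hs hy
    have hl := (l.le_opNorm _).trans (mul_le_mul_of_nonneg_left h (norm_nonneg l))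
    have hsum : l (∑ k ∈ Finset.range (m + 1), apostol z k y • ((Δ : ℂ) • A) ^ k) =
        (Δ : ℂ) ^ m * apostol z m y := by
      rw [map_sum, Finset.sum_range_succ, Finset.sum_eq_zero, zero_add, map_smul, _root_.smul_pow,
        map_smul, hlm]
      · simp [mul_comm]
      · intro k hk
        rw [map_smul, _root_.smul_pow, map_smul, hl0 k (Finset.mem_range.1 hk)]
        simp
    have hΔm : ((Δ : ℂ) ^ m) ≠ 0 := pow_ne_zero _ (by exact_mod_cast hΔ.ne')
    have e : g Δ y - φ Δ * apostol z m y = ((Δ : ℂ) ^ m)⁻¹ *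
        l (N Δ * NormedSpace.exp ((y : ℂ) • (Δ : ℂ) • A) -
          φ Δ • ∑ k ∈ Finset.range (m + 1), apostol z k y • ((Δ : ℂ) • A) ^ k) := by
      rw [map_sub, map_smul, hsum, smul_smul, hg]
      simp only [smul_eq_mul, Complex.ofReal_mul, mul_comm (y : ℂ)]
      field_simp
    rw [e, norm_mul, norm_inv, norm_pow, Complex.norm_real, Real.norm_of_nonneg hΔ.le]
    rw [inv_mul_le_iff₀ (by positivity)]
    refine hl.trans (le_of_eq ?_)
    rw [_root_.smul_pow, norm_smul, norm_pow, Complex.norm_real, Real.norm_of_nonneg hΔ.le, hR]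
    ring
  have hR0 : Tendsto R (𝓝[>] 0) (𝓝 0) := by
    have h1 : Tendsto (fun Δ : ℝ => Δ) (𝓝[>] 0) (𝓝 0) := nhdsWithin_le_nhds
    have h2 := ((((hφ.norm.mul_const B).mul_const ‖A ^ (m + 1)‖).const_mul (2 * K)).const_mul
      ‖l‖).mul h1
    simpa [hR] using h2
  have hlim : ∀ y ∈ Set.Icc (0 : ℝ) 1,
      Tendsto (fun Δ => g Δ y) (𝓝[>] 0) (𝓝 (φ₀ * apostol z m y)) := by
    intro y hy
    have h1 : Tendsto (fun Δ => g Δ y - φ Δ * apostol z m y) (𝓝[>] 0) (𝓝 0) :=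
      squeeze_zero_norm' (hrem.mono fun Δ h => h y hy) hR0
    simpa using h1.add (hφ.mul_const (apostol z m y))
  refine Tendsto.congr' (f₁ := fun Δ => ∫ y in (0 : ℝ)..1, Complex.normSq (g Δ y)) ?_ ?_
  · filter_upwards [self_mem_nhdsWithin] with Δ hΔ using (hscale Δ hΔ).symm
  refine intervalIntegral.tendsto_integral_filter_of_dominated_convergence
    (fun _ => (1 + (‖φ₀‖ + 1) * B) ^ 2) ?_ ?_ (by simp) ?_
  · refine Eventually.of_forall fun Δ => Continuous.aestronglyMeasurable ?_
    have h1 : Continuous fun y : ℝ => NormedSpace.exp (((Δ * y : ℝ) : ℂ) • A) :=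
      (differentiable_exp_smul_const ℂ A).continuous.comp (by fun_prop)
    exact Complex.continuous_normSq.comp
      (continuous_const.mul (l.continuous.comp (continuous_const.mul h1)))
  · filter_upwards [hrem, hR0.eventually (eventually_le_nhds zero_lt_one),
      hφ.norm.eventually (eventually_le_nhds (lt_add_one ‖φ₀‖))] with Δ h1 h2 h3
    refine Eventually.of_forall fun y hy => ?_
    rw [Set.uIoc_of_le zero_le_one] at hy
    have hy' := Set.Ioc_subset_Icc_self hy
    rw [Real.norm_of_nonneg (Complex.normSq_nonneg _), Complex.normSq_eq_norm_sq]
    refine pow_le_pow_left₀ (norm_nonneg _) ?_ 2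
    have h4 : ‖g Δ y‖ ≤ ‖g Δ y - φ Δ * apostol z m y‖ + ‖φ Δ * apostol z m y‖ := by
      simpa using norm_add_le (g Δ y - φ Δ * apostol z m y) (φ Δ * apostol z m y)
    refine h4.trans (add_le_add ((h1 y hy').trans h2) ?_)
    rw [norm_mul]
    exact mul_le_mul h3 (hB y hy') (norm_nonneg _) (by positivity)
  · refine Eventually.of_forall fun y hy => ?_
    rw [Set.uIoc_of_le zero_le_one] at hy
    exact (Complex.continuous_normSq.tendsto _).comp (hlim y (Set.Ioc_subset_Icc_self hy))

end BanachAlgebra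

/-! ### Horner schemes -/

section Horner

variable {R 𝔸 : Type*} [CommRing R] [Ring 𝔸] [Algebra R 𝔸]

/-- The Horner scheme `N₀ = φ₀`, `N_{i+1} = N_i M + φ_{i+1}`, that is
`N_i = ∑_{k ≤ i} φ_k M ^ (i - k)`. -/
def horner (φ : R[X]) (M : 𝔸) : ℕ → 𝔸
  | 0 => algebraMap R 𝔸 (φ.coeff 0)
  | i + 1 => horner φ M i * M + algebraMap R 𝔸 (φ.coeff (i + 1))

theorem horner_one_sub_mul (φ : R[X]) (M : 𝔸) (r : R) (i : ℕ) :
    horner ((1 - C r * X) * φ) M (i + 1) =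
      horner φ M (i + 1) - algebraMap R 𝔸 r * horner φ M i := by
  have hcoeff : ∀ k, ((1 - C r * X) * φ).coeff (k + 1) = φ.coeff (k + 1) - r * φ.coeff k := by
    intro k
    rw [sub_mul, one_mul, coeff_sub, mul_assoc, coeff_C_mul, coeff_X_mul]
  have hzero : ((1 - C r * X) * φ).coeff 0 = φ.coeff 0 := by
    simp [sub_mul, mul_assoc]
  induction i with
  | zero => simp only [horner, hcoeff, hzero, map_sub, map_mul]; abel
  | succ i ih =>
    rw [horner, ih, hcoeff, horner.eq_2 φ M (i + 1), horner.eq_2 φ M i]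
    simp only [map_sub, map_mul]
    noncomm_ring

theorem coeff_prod_one_sub_of_card_lt (S : Multiset R) {k : ℕ} (hk : S.card < k) :
    (S.map fun r => (1 - C r * X : R[X])).prod.coeff k = 0 := by
  induction S using Multiset.induction_on generalizing k with
  | empty =>
    simp only [Multiset.card_zero] at hk
    simp [coeff_one, hk.ne']
  | cons r S ih =>
    rw [Multiset.card_cons] at hk
    obtain ⟨k, rfl⟩ : ∃ j, k = j + 1 := ⟨k - 1, by omega⟩
    rw [Multiset.map_cons, Multiset.prod_cons, sub_mul, one_mul, coeff_sub, mul_assoc,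
      coeff_C_mul, coeff_X_mul, ih (by omega), ih (by omega)]
    simp

/-- The Horner scheme of `∏ (1 - r X)` ends with the value of the reversed polynomial
`∏ (X - r)`. -/
theorem horner_prod_one_sub (S : Multiset R) (M : 𝔸) :
    horner (S.map fun r => (1 - C r * X : R[X])).prod M S.card =
      aeval M (S.map fun r => (X - C r : R[X])).prod := by
  induction S using Multiset.induction_on with
  | empty => simp [horner]
  | cons r S ih =>
    rw [Multiset.map_cons, Multiset.prod_cons, Multiset.card_cons, horner_one_sub_mul, horner,
      coeff_prod_one_sub_of_card_lt S (Nat.lt_succ_self _), ih, Multiset.map_cons,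
      Multiset.prod_cons, mul_comm (X - C r), map_mul]
    simp only [map_zero, add_zero, map_sub, aeval_X, aeval_C, mul_sub]
    rw [Algebra.commutes]

/-- The generating polynomial of the Horner scheme is `φ(z) (1 - z M)⁻¹`, up to a remainder that
vanishes with `N_n`. -/
theorem sum_smul_horner_mul (φ : R[X]) (M : 𝔸) (z : R) (n : ℕ) :
    (∑ i ∈ Finset.range n, z ^ i • horner φ M i) * (1 - z • M) =
      algebraMap R 𝔸 (∑ k ∈ Finset.range (n + 1), φ.coeff k * z ^ k) - z ^ n • horner φ M n := by
  induction n with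
  | zero => simp [horner]
  | succ n ih =>
    rw [Finset.sum_range_succ, add_mul, ih, Finset.sum_range_succ _ (n + 1), horner, map_add,
      map_mul, mul_sub, mul_one, smul_add, smul_mul_assoc, mul_smul_comm, smul_smul, ← pow_succ,
      Algebra.smul_def (z ^ (n + 1)) (algebraMap R 𝔸 _), ← map_mul, ← map_mul,
      mul_comm (z ^ (n + 1))]
    abel

theorem map_horner {S 𝔹 : Type*} [CommRing S] [Ring 𝔹] [Algebra S 𝔹] (f : R →+* S) (g : 𝔸 →+* 𝔹)
    (hfg : ∀ r, g (algebraMap R 𝔸 r) = algebraMap S 𝔹 (f r)) (φ : R[X]) (M : 𝔸) (i : ℕ) :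
    g (horner φ M i) = horner (φ.map f) (g M) i := by
  induction i with
  | zero => simp [horner, hfg]
  | succ i ih => simp [horner, hfg, ih]

end Horner

/-- Unrolling the recursion `x_n = M x_{n-1} + r_n` in a filter of `x`. -/
theorem sum_filter_eq_horner {ι : Type*} [Fintype ι] [DecidableEq ι] (φ : ℝ[X])
    (M : Matrix ι ι ℝ) {x r : ℤ → ι → ℝ} (hx : ∀ n, x n = M *ᵥ x (n - 1) + r n) (n : ℤ) (i : ℕ) :
    ∑ k ∈ Finset.range (i + 1), φ.coeff k • x (n - k) =
      horner φ M i *ᵥ x (n - i) + ∑ j ∈ Finset.range i, horner φ M j *ᵥ r (n - j) := by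
  have hscalar : ∀ (t : ℝ) (v : ι → ℝ), algebraMap ℝ (Matrix ι ι ℝ) t *ᵥ v = t • v := by
    intro t v
    rw [Algebra.algebraMap_eq_smul_one, Matrix.smul_mulVec, Matrix.one_mulVec]
  induction i with
  | zero => simp [horner, hscalar]
  | succ i ih =>
    rw [Finset.sum_range_succ, ih, Finset.sum_range_succ _ i, horner, Matrix.add_mulVec, hscalar,
      ← Matrix.mulVec_mulVec, hx (n - i), Matrix.mulVec_add]
    push_cast
    rw [show n - (i : ℤ) - 1 = n - (i + 1) by ring]
    abel

/-! ### The companion matrix and its exponentials -/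

/-- The standard basis row vectors of `ℝ ^ p`, indexed by natural numbers. -/
def stdRow (p j : ℕ) : Fin p → ℝ := fun i => if (i : ℕ) = j then 1 else 0

theorem stdRow_vecMul {p : ℕ} (T : Matrix (Fin p) (Fin p) ℝ) (j i : Fin p) :
    (stdRow p j ᵥ* T) i = T j i := by
  rw [Matrix.vecMul, dotProduct, Finset.sum_eq_single j]
  · simp [stdRow]
  · intro k _ hk
    simp [stdRow, Fin.val_inj, hk]
  · simp

theorem stdRow_vecMul_stateMatrix {p : ℕ} (a : ℝ[X]) {j : ℕ} (hj : j + 1 < p) :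
    stdRow p j ᵥ* stateMatrix p a = stdRow p (j + 1) := by
  ext i
  rw [stdRow_vecMul _ ⟨j, by omega⟩]
  simp [stateMatrix, stdRow, hj.ne]

theorem stdRow_vecMul_stateMatrix_pow {p : ℕ} (a : ℝ[X]) {j : ℕ} (hj : j < p) :
    stdRow p 0 ᵥ* stateMatrix p a ^ j = stdRow p j := by
  induction j with
  | zero => simp
  | succ j ih =>
    rw [pow_succ, ← Matrix.vecMul_vecMul, ih (by omega), stdRow_vecMul_stateMatrix a hj]

theorem aeval_stateMatrix {p : ℕ} {a : ℝ[X]} (ha : a.Monic) (hp : a.natDegree = p) :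
    aeval (stateMatrix p a) a = 0 := by
  rcases Nat.eq_zero_or_pos p with rfl | hpos
  · ext i
    exact i.elim0
  set A := stateMatrix p a
  have h0 : stdRow p 0 ᵥ* aeval A a = 0 := by
    have hlast : stdRow p 0 ᵥ* A ^ p = fun i : Fin p => -a.coeff i := by
      obtain ⟨n, rfl⟩ : ∃ n, p = n + 1 := ⟨p - 1, by omega⟩
      rw [pow_succ, ← Matrix.vecMul_vecMul, stdRow_vecMul_stateMatrix_pow a (Nat.lt_succ_self n)]
      ext i
      rw [stdRow_vecMul _ (⟨n, Nat.lt_succ_self n⟩ : Fin (n + 1))]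
      simp [A, stateMatrix]
    have hlead : a.coeff p = 1 := by rw [← hp, ha.coeff_natDegree]
    rw [aeval_eq_sum_range, hp, Matrix.vecMul_sum, Finset.sum_range_succ, hlead, one_smul, hlast]
    ext i
    rw [Pi.add_apply, Finset.sum_apply, Finset.sum_eq_single (i : ℕ)]
    · rw [Matrix.vecMul_smul, stdRow_vecMul_stateMatrix_pow a i.2]
      simp [stdRow]
    · intro k hk hki
      rw [Matrix.vecMul_smul, stdRow_vecMul_stateMatrix_pow a (Finset.mem_range.1 hk)]
      simp [stdRow, Ne.symm hki]
    · simp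
  ext j i
  rw [← stdRow_vecMul (aeval A a) j i, ← stdRow_vecMul_stateMatrix_pow a j.2, Matrix.vecMul_vecMul]
  have hcomm : A ^ (j : ℕ) * aeval A a = aeval A a * A ^ (j : ℕ) := by
    have h := aeval_X_pow (R := ℝ) A (n := (j : ℕ))
    rw [← h, ← map_mul, mul_comm, map_mul]
  rw [hcomm, ← Matrix.vecMul_vecMul, h0, Matrix.zero_vecMul]
  rfl

theorem stateMatrix_pow_mulVec_lastVec {p : ℕ} (a : ℝ[X]) (k : ℕ) (i : Fin p)
    (hik : (i : ℕ) + k + 1 ≤ p) :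
    (stateMatrix p a ^ k *ᵥ lastVec p) i = if (i : ℕ) + k + 1 = p then 1 else 0 := by
  induction k generalizing i with
  | zero => simp [lastVec]
  | succ k ih =>
    rw [pow_succ', ← Matrix.mulVec_mulVec, Matrix.mulVec, dotProduct,
      Finset.sum_eq_single (⟨i + 1, by omega⟩ : Fin p)]
    · rw [ih _ (by simp; omega)]
      have h : (i : ℕ) + 1 ≠ p := by omega
      simp only [stateMatrix, Matrix.of_apply, h, if_true, if_false, one_mul]
      congr 1
      simp only [eq_iff_iff]
      omega
    · intro j _ hj
      have h : (i : ℕ) + 1 ≠ p := by omega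
      have h2 : (j : ℕ) ≠ i + 1 := fun e => hj (Fin.ext e)
      simp [stateMatrix, h, h2]
    · simp

/-- The first nonvanishing moment `bᵀ A ^ k e_p` is that of order `p - q - 1`. -/
theorem sum_coeff_mul_stateMatrix_pow {p q : ℕ} (hqp : q < p) (a : ℝ[X]) {b : ℝ[X]}
    (hb : b.Monic) (hbq : b.natDegree = q) {k : ℕ} (hk : k ≤ p - q - 1) :
    (fun j : Fin p => b.coeff j) ⬝ᵥ (stateMatrix p a ^ k *ᵥ lastVec p) =
      if k = p - q - 1 then 1 else 0 := by
  rw [dotProduct, Finset.sum_eq_single (⟨q, hqp⟩ : Fin p)]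
  · rw [stateMatrix_pow_mulVec_lastVec a k _ (by simp; omega)]
    simp only [← hbq, hb.coeff_natDegree, one_mul]
    congr 1
    simp only [eq_iff_iff]
    omega
  · intro j _ hj
    have h2 : (j : ℕ) ≠ q := fun e => hj (Fin.ext e)
    rcases lt_or_gt_of_ne h2 with h | h
    · rw [stateMatrix_pow_mulVec_lastVec a k _ (by omega), if_neg (by omega), mul_zero]
    · rw [coeff_eq_zero_of_natDegree_lt (by omega), zero_mul]
  · simp

section Exponential

variable {𝔸 : Type*} [NormedRing 𝔸] [NormedAlgebra ℂ 𝔸] [CompleteSpace 𝔸]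

theorem exists_exp_sub_one_eq_mul (B : 𝔸) :
    ∃ T : 𝔸, NormedSpace.exp B - 1 = B * T ∧ ∀ D, Commute B D → Commute T D := by
  have hs := NormedSpace.expSeries_summable' (𝕂 := ℂ) B
  have hs' : Summable fun n : ℕ => ((n + 1).factorial⁻¹ : ℂ) • B ^ n := by
    refine Summable.of_norm_bounded (NormedSpace.norm_expSeries_summable' (𝕂 := ℂ) B) fun n => ?_
    rw [norm_smul, norm_smul]
    refine mul_le_mul_of_nonneg_right ?_ (norm_nonneg _)
    rw [norm_inv, norm_inv, Complex.norm_natCast, Complex.norm_natCast]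
    gcongr
    omega
  refine ⟨∑' n : ℕ, ((n + 1).factorial⁻¹ : ℂ) • B ^ n, ?_, fun D hD => ?_⟩
  · rw [NormedSpace.exp_eq_tsum ℂ]
    simp only
    rw [hs.tsum_eq_zero_add, ← hs'.tsum_mul_left]
    simp [pow_succ']
  · exact (Commute.tsum_right D fun n => ((hD.symm.pow_right n).smul_right _)).symm

theorem exists_exp_sub_exp_eq_mul (A : 𝔸) (t l : ℂ) :
    ∃ T : 𝔸, NormedSpace.exp (t • A) - algebraMap ℂ 𝔸 (Complex.exp (l * t)) =
      (A - algebraMap ℂ 𝔸 l) * T ∧ ∀ D, Commute A D → Commute T D := by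
  obtain ⟨T, hT, hc⟩ := exists_exp_sub_one_eq_mul (t • (A - algebraMap ℂ 𝔸 l))
  let _ : NormedAlgebra ℚ 𝔸 := NormedAlgebra.restrictScalars ℚ ℂ 𝔸
  have hA : t • A = t • (A - algebraMap ℂ 𝔸 l) + algebraMap ℂ 𝔸 (l * t) := by
    rw [smul_sub, map_mul, ← Algebra.commutes, ← Algebra.smul_def, sub_add_cancel]
  have hexp : NormedSpace.exp (t • A) = algebraMap ℂ 𝔸 (Complex.exp (l * t)) *
      NormedSpace.exp (t • (A - algebraMap ℂ 𝔸 l)) := by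
    rw [hA, NormedSpace.exp_add_of_commute (Algebra.commutes _ _).symm, Algebra.commutes,
      Complex.exp_eq_exp_ℂ, NormedSpace.algebraMap_exp_comm]
  refine ⟨algebraMap ℂ 𝔸 (Complex.exp (l * t) * t) * T, ?_, fun D hD => ?_⟩
  · have h : algebraMap ℂ 𝔸 (Complex.exp (l * t)) *
        (NormedSpace.exp (t • (A - algebraMap ℂ 𝔸 l)) - 1) =
        algebraMap ℂ 𝔸 (Complex.exp (l * t)) * (t • (A - algebraMap ℂ 𝔸 l) * T) := by rw [hT]
    rw [hexp, ← mul_sub_one, h, Algebra.smul_def, map_mul, ← mul_assoc, ← mul_assoc, ← mul_assoc,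
      ← map_mul, Algebra.commutes]
  · refine Commute.mul_left (Algebra.commutes _ _) (hc D ?_)
    exact (hD.sub_left (Algebra.commutes _ _)).smul_left _

/-- Multiplicity-free spectral mapping is not enough for Cayley–Hamilton: each factor
`exp (t A) - exp (t l)` is a multiple of `A - l` by an element commuting with `A`, which accounts
for multiplicities. -/
theorem aeval_exp_prod_eq_mul (A : 𝔸) (t : ℂ) (S : Multiset ℂ) :
    ∃ T : 𝔸, aeval (NormedSpace.exp (t • A)) (S.map fun l => X - C (Complex.exp (l * t))).prod =
      aeval A (S.map fun l => X - C l).prod * T := by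
  induction S using Multiset.induction_on with
  | empty => exact ⟨1, by simp⟩
  | cons l S ih =>
    obtain ⟨T, hT⟩ := ih
    obtain ⟨T', hT', hc⟩ := exists_exp_sub_exp_eq_mul A t l
    refine ⟨T' * T, ?_⟩
    have hcomm : Commute T' (aeval A (S.map fun l => X - C l).prod) := by
      refine hc _ ?_
      have h := (Commute.all X (S.map fun l => X - C l).prod).map (aeval A : ℂ[X] →ₐ[ℂ] 𝔸)
      rwa [aeval_X] at h
    rw [Multiset.map_cons, Multiset.prod_cons, Multiset.map_cons, Multiset.prod_cons, map_mul,
      map_mul, hT]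
    simp only [map_sub, aeval_X, aeval_C]
    rw [hT', mul_assoc, mul_assoc, ← mul_assoc T', hcomm.eq, mul_assoc]

end Exponential

/-! ### Second moments of a Lévy process -/

section Levy

variable {Ω : Type*} [MeasurableSpace Ω] {P : Measure Ω} {L : ℝ → Ω → ℝ} {σ : ℝ}

theorem IsSecondOrderLevy.memLp_sub (hL : IsSecondOrderLevy P L σ) (s t : ℝ) :
    MemLp (fun ω => L t ω - L s ω) 2 P :=
  (hL.memLp_two t).sub (hL.memLp_two s)

theorem IsSecondOrderLevy.integral_sub_sq_eq (hL : IsSecondOrderLevy P L σ) (s t : ℝ) :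
    ∫ ω, (L t ω - L s ω) ^ 2 ∂P = ∫ ω, (L (t - s) ω) ^ 2 ∂P := by
  have h := (hL.stationary_increments 0 (t - s) s).comp (u := fun x : ℝ => x ^ 2) (by fun_prop)
  have h2 := h.integral_eq
  simp only [Function.comp_def, sub_add_cancel, zero_add] at h2
  rw [h2]
  refine integral_congr_ae ?_
  filter_upwards [hL.zero] with ω hω
  rw [hω, sub_zero]

variable [IsProbabilityMeasure P]

theorem IsSecondOrderLevy.integral_sub (hL : IsSecondOrderLevy P L σ) (s t : ℝ) :
    ∫ ω, (L t ω - L s ω) ∂P = 0 := by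
  rw [MeasureTheory.integral_sub ((hL.memLp_two t).integrable (by simp))
    ((hL.memLp_two s).integrable (by simp)), hL.mean_zero, hL.mean_zero, sub_zero]

theorem IsSecondOrderLevy.integral_sq_add (hL : IsSecondOrderLevy P L σ) {s t : ℝ} (hs : 0 ≤ s)
    (ht : 0 ≤ t) : ∫ ω, (L (s + t) ω) ^ 2 ∂P =
      ∫ ω, (L s ω) ^ 2 ∂P + ∫ ω, (L t ω) ^ 2 ∂P := by
  have hind := hL.indep_increments.indepFun_sub_sub hs (by linarith : s ≤ s + t)
  have hm1 := hL.memLp_sub 0 s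
  have hm2 := hL.memLp_sub s (s + t)
  have hprod : ∫ ω, (L s ω - L 0 ω) * (L (s + t) ω - L s ω) ∂P = 0 := by
    have h := hind.integral_mul_eq_mul_integral hm1.1 hm2.1
    have h2 := hL.integral_sub 0 s
    simp only [Pi.mul_apply, Pi.sub_apply] at h
    rw [h, h2, zero_mul]
  have e1 := hL.integral_sub_sq_eq 0 s
  have e2 := hL.integral_sub_sq_eq s (s + t)
  rw [sub_zero] at e1
  rw [add_sub_cancel_left] at e2
  rw [← e1, ← e2]
  have h3 : ∫ ω, (L (s + t) ω) ^ 2 ∂P = ∫ ω, ((L s ω - L 0 ω) ^ 2 +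
      2 * ((L s ω - L 0 ω) * (L (s + t) ω - L s ω)) + (L (s + t) ω - L s ω) ^ 2) ∂P := by
    refine integral_congr_ae ?_
    filter_upwards [hL.zero] with ω hω
    rw [hω]
    ring
  have hi : Integrable (fun ω => 2 * ((L s ω - L 0 ω) * (L (s + t) ω - L s ω))) P :=
    (hm1.integrable_mul hm2).const_mul 2
  rw [h3, integral_add _ hm2.integrable_sq, integral_add hm1.integrable_sq hi,
    integral_const_mul, hprod]
  · ring
  · exact hm1.integrable_sq.add hi

theorem IsSecondOrderLevy.integral_sq_nat_mul (hL : IsSecondOrderLevy P L σ) {t : ℝ} (ht : 0 ≤ t)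
    (n : ℕ) : ∫ ω, (L (n * t) ω) ^ 2 ∂P = n * ∫ ω, (L t ω) ^ 2 ∂P := by
  induction n with
  | zero =>
    have h : ∫ ω, (L 0 ω) ^ 2 ∂P = ∫ _, (0 : ℝ) ∂P := by
      refine integral_congr_ae ?_
      filter_upwards [hL.zero] with ω hω
      simp [hω]
    simpa using h
  | succ n ih =>
    push_cast
    rw [add_mul, one_mul, hL.integral_sq_add (by positivity) ht, ih]
    ring

/-- The second moment is additive and monotone in time, hence linear. -/
theorem IsSecondOrderLevy.integral_sq (hL : IsSecondOrderLevy P L σ) {t : ℝ} (ht : 0 ≤ t) :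
    ∫ ω, (L t ω) ^ 2 ∂P = σ ^ 2 * t := by
  set v : ℝ → ℝ := fun t => ∫ ω, (L t ω) ^ 2 ∂P with hv
  have hnn : ∀ t, 0 ≤ v t := fun t => integral_nonneg fun ω => sq_nonneg _
  have hmono : ∀ s t, 0 ≤ s → s ≤ t → v s ≤ v t := by
    intro s t hs hst
    have h := hL.integral_sq_add hs (sub_nonneg.2 hst)
    rw [add_sub_cancel] at h
    have := hnn (t - s)
    simp only [hv] at this ⊢
    linarith
  have hnat : ∀ n : ℕ, v n = n * σ ^ 2 := by
    intro n
    have h := hL.integral_sq_nat_mul zero_le_one n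
    rw [mul_one, hL.second_moment] at h
    exact h
  have hbound : ∀ n : ℕ, |(v t - σ ^ 2 * t) * n| ≤ σ ^ 2 := by
    intro n
    have hmul : v (n * t) = n * v t := hL.integral_sq_nat_mul ht n
    have hnt : 0 ≤ n * t := by positivity
    have h1 := hmono _ _ (Nat.cast_nonneg _) (Nat.floor_le hnt)
    have h2 := hmono _ _ hnt (Nat.lt_floor_add_one (n * t)).le
    have h3 := hnat ⌊n * t⌋₊
    have h4 := hnat (⌊n * t⌋₊ + 1)
    push_cast at h4
    rw [h4, hmul] at h2
    rw [h3, hmul] at h1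
    have h5 := Nat.floor_le hnt
    have h6 := (Nat.lt_floor_add_one (n * t)).le
    have h7 := sq_nonneg σ
    rw [abs_le]
    constructor <;> nlinarith
  by_contra hne
  have hpos : 0 < |v t - σ ^ 2 * t| := abs_pos.2 (sub_ne_zero.2 hne)
  obtain ⟨n, hn⟩ := exists_nat_gt (σ ^ 2 / |v t - σ ^ 2 * t|)
  have h := hbound n
  rw [div_lt_iff₀ hpos] at hn
  rw [abs_mul, Nat.abs_cast] at h
  linarith

theorem IsSecondOrderLevy.integral_sub_sq (hL : IsSecondOrderLevy P L σ) (s t : ℝ) :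
    ∫ ω, (L t ω - L s ω) ^ 2 ∂P = σ ^ 2 * |t - s| := by
  rcases le_total s t with h | h
  · rw [hL.integral_sub_sq_eq, hL.integral_sq (sub_nonneg.2 h), abs_of_nonneg (sub_nonneg.2 h)]
  · simp_rw [fun ω => show (L t ω - L s ω) ^ 2 = (L s ω - L t ω) ^ 2 by ring]
    rw [hL.integral_sub_sq_eq, hL.integral_sq (sub_nonneg.2 h), abs_sub_comm,
      abs_of_nonneg (sub_nonneg.2 h)]

theorem IsSecondOrderLevy.integral_sub_mul_sub (hL : IsSecondOrderLevy P L σ) (a b d e : ℝ) :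
    ∫ ω, (L a ω - L b ω) * (L d ω - L e ω) ∂P =
      σ ^ 2 / 2 * (|a - e| + |b - d| - |a - d| - |b - e|) := by
  have h : ∀ ω, (L a ω - L b ω) * (L d ω - L e ω) = 2⁻¹ * ((L a ω - L e ω) ^ 2 +
      (L b ω - L d ω) ^ 2 - (L a ω - L d ω) ^ 2 - (L b ω - L e ω) ^ 2) := fun ω => by ring
  simp_rw [h]
  have i1 := (hL.memLp_sub e a).integrable_sq
  have i2 := (hL.memLp_sub d b).integrable_sq
  have i3 := (hL.memLp_sub d a).integrable_sq
  have i4 := (hL.memLp_sub e b).integrable_sq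
  have i12 : Integrable (fun ω => (L a ω - L e ω) ^ 2 + (L b ω - L d ω) ^ 2) P := i1.add i2
  have i123 : Integrable (fun ω => (L a ω - L e ω) ^ 2 + (L b ω - L d ω) ^ 2 -
      (L a ω - L d ω) ^ 2) P := i12.sub i3
  rw [integral_const_mul, MeasureTheory.integral_sub i123 i4, MeasureTheory.integral_sub i12 i3,
    integral_add i1 i2, hL.integral_sub_sq, hL.integral_sub_sq, hL.integral_sub_sq,
    hL.integral_sub_sq]
  ring

end Levy

/-! ### Wiener integrals of smooth kernels -/

section Wiener

variable {Ω : Type*} [MeasurableSpace Ω] {P : Measure Ω} {L : ℝ → Ω → ℝ} {σ : ℝ}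

/-- Right-continuity makes the process jointly measurable: it is the pointwise limit of its
discretisations from the right. -/
theorem IsLevyProcess.aemeasurable_uncurry (hL : IsLevyProcess P L) (μ : Measure ℝ) [SFinite μ] :
    AEMeasurable (fun x : Ω × ℝ => L x.2 x.1) (P.prod μ) := by
  refine aemeasurable_of_tendsto_metrizable_ae atTop
    (f := fun (n : ℕ) (x : Ω × ℝ) => L ((⌊((n : ℝ) + 1) * x.2⌋ + 1) / ((n : ℝ) + 1)) x.1)
    (fun n => Measurable.aemeasurable ?_) ?_
  · have h1 : Measurable fun y : ℤ × Ω => L ((y.1 + 1) / ((n : ℝ) + 1)) y.2 :=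
      measurable_from_prod_countable_right fun k => hL.measurable (((k : ℝ) + 1) / ((n : ℝ) + 1))
    have h2 : Measurable fun x : Ω × ℝ => (⌊((n : ℝ) + 1) * x.2⌋, x.1) :=
      (Int.measurable_floor.comp (measurable_snd.const_mul _)).prodMk measurable_fst
    exact h1.comp h2
  · have hae : ∀ᵐ x ∂(P.prod μ), ∀ t, ContinuousWithinAt (fun s => L s x.1) (Set.Ici t) t :=
      (Measure.quasiMeasurePreserving_fst.ae hL.cadlag).mono fun x hx t => (hx t).1
    filter_upwards [hae] with x hx
    refine (hx x.2).tendsto.comp (tendsto_nhdsWithin_iff.2 ⟨?_, Eventually.of_forall fun n => ?_⟩)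
    · have h0 : Tendsto (fun n : ℕ => x.2 + 1 / ((n : ℝ) + 1)) atTop (𝓝 (x.2 + 0)) :=
        tendsto_const_nhds.add tendsto_one_div_add_atTop_nhds_zero_nat
      rw [add_zero] at h0
      refine tendsto_of_tendsto_of_tendsto_of_le_of_le tendsto_const_nhds h0 (fun n => ?_)
        fun n => ?_
      · have hn : (0 : ℝ) < n + 1 := by positivity
        simp only
        rw [le_div_iff₀ hn]
        linarith [Int.lt_floor_add_one (((n : ℝ) + 1) * x.2)]
      · have hn : (0 : ℝ) < n + 1 := by positivity
        simp only
        rw [add_div]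
        gcongr
        rw [div_le_iff₀ hn]
        linarith [Int.floor_le (((n : ℝ) + 1) * x.2)]
    · have hn : (0 : ℝ) < n + 1 := by positivity
      rw [Set.mem_Ici, le_div_iff₀ hn]
      linarith [Int.lt_floor_add_one (((n : ℝ) + 1) * x.2)]

/-- The Wiener integral `∫_s^t f (t - u) dL_u` of a `C¹` kernel `f` with derivative `f'`, defined
pathwise through integration by parts. -/
def wienerIntegral (L : ℝ → Ω → ℝ) (s t : ℝ) (f f' : ℝ → ℝ) (ω : Ω) : ℝ :=
  f 0 * (L t ω - L s ω) + ∫ u in s..t, f' (t - u) * (L u ω - L s ω)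

variable [IsProbabilityMeasure P]

theorem IsSecondOrderLevy.memLp_prod (hL : IsSecondOrderLevy P L σ) (s t : ℝ) {k : ℝ → ℝ}
    (hk : Continuous k) :
    MemLp (fun x : Ω × ℝ => k x.2 * (L x.2 x.1 - L s x.1)) 2
      (P.prod (volume.restrict (Set.Ioc s t))) := by
  set μ := volume.restrict (Set.Ioc s t)
  have hm : AEStronglyMeasurable (fun x : Ω × ℝ => k x.2 * (L x.2 x.1 - L s x.1)) (P.prod μ) := by
    refine AEMeasurable.aestronglyMeasurable ?_
    exact (hk.measurable.comp measurable_snd).aemeasurable.mul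
      ((hL.aemeasurable_uncurry μ).sub ((hL.measurable s).comp measurable_fst).aemeasurable)
  rw [memLp_two_iff_integrable_sq hm, integrable_prod_iff' (by exact hm.pow 2)]
  have hsq : ∀ u, ∫ ω, ‖(k u * (L u ω - L s ω)) ^ 2‖ ∂P = k u ^ 2 * (σ ^ 2 * |u - s|) := by
    intro u
    rw [← hL.integral_sub_sq, ← integral_const_mul]
    refine integral_congr_ae (Eventually.of_forall fun ω => ?_)
    simp only
    rw [Real.norm_of_nonneg (sq_nonneg _), mul_pow]
  constructor
  · refine Eventually.of_forall fun u => ?_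
    exact ((hL.memLp_sub s u).const_mul (k u)).integrable_sq
  · simp only [hsq]
    exact (Continuous.integrableOn_Icc (by fun_prop)).mono_set Set.Ioc_subset_Icc_self

theorem IsSecondOrderLevy.memLp_integral (hL : IsSecondOrderLevy P L σ) {s t : ℝ} (hst : s ≤ t)
    {k : ℝ → ℝ} (hk : Continuous k) :
    MemLp (fun ω => ∫ u in s..t, k u * (L u ω - L s ω)) 2 P := by
  have h := hL.memLp_prod s t hk
  simp_rw [intervalIntegral.integral_of_le hst]
  have hm := h.1.integral_prod_right'
  rw [memLp_two_iff_integrable_sq hm]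
  have hi := h.integrable_sq
  refine Integrable.mono' ((hi.integral_prod_left).const_mul (t - s)) (hm.pow 2) ?_
  filter_upwards [hi.prod_right_ae, (h.integrable (by simp)).prod_right_ae] with ω h2 h1
  rw [Real.norm_of_nonneg (sq_nonneg _)]
  rcases hst.eq_or_lt with rfl | hlt
  · simp
  -- Cauchy–Schwarz, from the nonnegative integral of the squared deviation from the mean
  set μ := volume.restrict (Set.Ioc s t)
  set F : ℝ → ℝ := fun u => k u * (L u ω - L s ω)
  set I := ∫ u, F u ∂μ
  have hpos : 0 < t - s := sub_pos.2 hlt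
  have hvol : ∫ _, (1 : ℝ) ∂μ = t - s := by
    simp [μ, hst]
  have h3 : 0 ≤ ∫ u, (F u - I / (t - s)) ^ 2 ∂μ := integral_nonneg fun u => sq_nonneg _
  have h4 : ∫ u, (F u - I / (t - s)) ^ 2 ∂μ =
      ∫ u, F u ^ 2 ∂μ - 2 * (I / (t - s)) * I + (I / (t - s)) ^ 2 * (t - s) := by
    have e : ∀ u, (F u - I / (t - s)) ^ 2 =
        F u ^ 2 - 2 * (I / (t - s)) * F u + (I / (t - s)) ^ 2 * 1 := fun u => by ring
    simp_rw [e]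
    have i1 : Integrable (fun u => 2 * (I / (t - s)) * F u) μ := h1.const_mul _
    have i2 : Integrable (fun u => F u ^ 2 - 2 * (I / (t - s)) * F u) μ := h2.sub i1
    rw [integral_add i2 ((integrable_const _).const_mul _), MeasureTheory.integral_sub h2 i1,
      integral_const_mul, integral_const_mul, hvol]
  rw [h4] at h3
  have h5 : ∫ u, F u ^ 2 ∂μ - 2 * (I / (t - s)) * I + (I / (t - s)) ^ 2 * (t - s) =
      ∫ u, F u ^ 2 ∂μ - I ^ 2 / (t - s) := by
    field_simp
    ring
  rw [h5, sub_nonneg, div_le_iff₀ hpos] at h3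
  linarith

theorem IsSecondOrderLevy.integral_mul_integral (hL : IsSecondOrderLevy P L σ) {s t : ℝ}
    (hst : s ≤ t) {k : ℝ → ℝ} (hk : Continuous k) {Z : Ω → ℝ} (hZ : MemLp Z 2 P) :
    ∫ ω, (Z ω * ∫ u in s..t, k u * (L u ω - L s ω)) ∂P =
      ∫ u in s..t, k u * ∫ ω, Z ω * (L u ω - L s ω) ∂P := by
  simp_rw [intervalIntegral.integral_of_le hst]
  have h := (hZ.comp_fst (volume.restrict (Set.Ioc s t))).integrable_mul (hL.memLp_prod s t hk)
  have h2 := integral_integral_swap (f := fun ω u => Z ω * (k u * (L u ω - L s ω))) h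
  simp_rw [integral_const_mul] at h2
  rw [h2]
  refine integral_congr_ae (Eventually.of_forall fun u => ?_)
  simp only
  rw [← integral_const_mul]
  refine integral_congr_ae (Eventually.of_forall fun ω => ?_)
  simp only
  ring

variable {s t : ℝ} {f f' g g' : ℝ → ℝ}

theorem IsSecondOrderLevy.memLp_wienerIntegral (hL : IsSecondOrderLevy P L σ) (hst : s ≤ t)
    (hf' : Continuous f') : MemLp (wienerIntegral L s t f f') 2 P :=
  ((hL.memLp_sub s t).const_mul (f 0)).add
    (hL.memLp_integral hst (k := fun u => f' (t - u)) (by fun_prop))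

theorem IsSecondOrderLevy.integral_mul_wienerIntegral (hL : IsSecondOrderLevy P L σ)
    (hst : s ≤ t) (hf' : Continuous f') {Z : Ω → ℝ} (hZ : MemLp Z 2 P) :
    ∫ ω, Z ω * wienerIntegral L s t f f' ω ∂P = f 0 * ∫ ω, Z ω * (L t ω - L s ω) ∂P +
      ∫ u in s..t, f' (t - u) * ∫ ω, Z ω * (L u ω - L s ω) ∂P := by
  have hk : Continuous fun u => f' (t - u) := by fun_prop
  have e : ∀ ω, Z ω * wienerIntegral L s t f f' ω = f 0 * (Z ω * (L t ω - L s ω)) +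
      Z ω * ∫ u in s..t, f' (t - u) * (L u ω - L s ω) := fun ω => by
    rw [wienerIntegral]
    ring
  simp_rw [e]
  have i1 : Integrable (fun ω => f 0 * (Z ω * (L t ω - L s ω))) P :=
    (hZ.integrable_mul (hL.memLp_sub s t)).const_mul _
  have i2 : Integrable (fun ω => Z ω * ∫ u in s..t, f' (t - u) * (L u ω - L s ω)) P :=
    hZ.integrable_mul (hL.memLp_integral hst hk)
  rw [integral_add i1 i2, integral_const_mul, hL.integral_mul_integral hst hk hZ]

theorem IsSecondOrderLevy.integral_wienerIntegral (hL : IsSecondOrderLevy P L σ) (hst : s ≤ t)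
    (hf' : Continuous f') : ∫ ω, wienerIntegral L s t f f' ω ∂P = 0 := by
  have h := hL.integral_mul_wienerIntegral (f := f) hst hf' (Z := fun _ => 1) (memLp_const 1)
  simpa [hL.integral_sub] using h

theorem IsSecondOrderLevy.integral_sub_mul_wienerIntegral (hL : IsSecondOrderLevy P L σ)
    (hf : ∀ x, HasDerivAt f (f' x) x) (hf' : Continuous f') {r : ℝ} (hr : s ≤ r) (hrt : r ≤ t) :
    ∫ ω, (L r ω - L s ω) * wienerIntegral L s t f f' ω ∂P =
      σ ^ 2 * ∫ u in s..r, f (t - u) := by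
  have hfc : Continuous f := continuous_iff_continuousAt.2 fun x => (hf x).continuousAt
  have hd : ∀ u, HasDerivAt (fun u => f (t - u)) (-f' (t - u)) u := fun u => by
    exact (hf (t - u)).comp_const_sub t u
  rw [hL.integral_mul_wienerIntegral (hr.trans hrt) hf' (hL.memLp_sub s r)]
  have hcov : ∀ u, s ≤ u → ∫ ω, (L r ω - L s ω) * (L u ω - L s ω) ∂P =
      σ ^ 2 * (min r u - s) := by
    intro u hu
    rw [hL.integral_sub_mul_sub, abs_of_nonneg (by linarith : 0 ≤ r - s),
      abs_of_nonpos (by linarith : s - u ≤ 0), sub_self, abs_zero]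
    rcases le_total r u with h | h
    · rw [min_eq_left h, abs_of_nonpos (by linarith)]
      ring
    · rw [min_eq_right h, abs_of_nonneg (by linarith)]
      ring
  rw [hcov t (hr.trans hrt), min_eq_left hrt]
  have h1 : ∫ u in s..t, f' (t - u) * ∫ ω, (L r ω - L s ω) * (L u ω - L s ω) ∂P =
      ∫ u in s..t, f' (t - u) * (σ ^ 2 * (min r u - s)) := by
    refine intervalIntegral.integral_congr fun u hu => ?_
    rw [Set.uIcc_of_le (hr.trans hrt)] at hu
    simp only [hcov u hu.1]
  have hc : Continuous fun u => f' (t - u) * (σ ^ 2 * (min r u - s)) := by fun_prop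
  rw [h1, ← intervalIntegral.integral_add_adjacent_intervals (b := r)
    (hc.intervalIntegrable _ _) (hc.intervalIntegrable _ _)]
  have h2 : ∫ u in r..t, f' (t - u) * (σ ^ 2 * (min r u - s)) =
      σ ^ 2 * (r - s) * (f (t - r) - f 0) := by
    have e : ∫ u in r..t, f' (t - u) * (σ ^ 2 * (min r u - s)) =
        ∫ u in r..t, (σ ^ 2 * (r - s)) * f' (t - u) := by
      refine intervalIntegral.integral_congr fun u hu => ?_
      rw [Set.uIcc_of_le hrt] at hu
      simp only [min_eq_left hu.1]
      ring
    rw [e, intervalIntegral.integral_const_mul]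
    have h3 := intervalIntegral.integral_eq_sub_of_hasDerivAt (a := r) (b := t)
      (fun u _ => (hd u).neg)
      (by simp only [neg_neg]; exact Continuous.intervalIntegrable (by fun_prop) _ _)
    simp only [neg_neg, Pi.neg_apply, sub_self] at h3
    rw [h3]
    ring
  have h4 : ∫ u in s..r, f' (t - u) * (σ ^ 2 * (min r u - s)) =
      σ ^ 2 * (∫ u in s..r, f (t - u)) - σ ^ 2 * (r - s) * f (t - r) := by
    have e : ∫ u in s..r, f' (t - u) * (σ ^ 2 * (min r u - s)) =
        ∫ u in s..r, (σ ^ 2 * f (t - u) -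
          (σ ^ 2 * 1 * f (t - u) + σ ^ 2 * (u - s) * -f' (t - u))) := by
      refine intervalIntegral.integral_congr fun u hu => ?_
      rw [Set.uIcc_of_le hr] at hu
      simp only [min_eq_right hu.2]
      ring
    have h5 := intervalIntegral.integral_eq_sub_of_hasDerivAt (a := s) (b := r)
      (f := fun u => σ ^ 2 * (u - s) * f (t - u))
      (fun u _ => ((((hasDerivAt_id u).sub_const s).const_mul (σ ^ 2)).mul (hd u)))
      (Continuous.intervalIntegrable (by fun_prop) _ _)
    simp only [id] at h5
    rw [e, intervalIntegral.integral_sub (Continuous.intervalIntegrable (by fun_prop) _ _)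
      (Continuous.intervalIntegrable (by fun_prop) _ _), h5, intervalIntegral.integral_const_mul]
    ring
  rw [h2, h4]
  ring

/-- The Itô isometry for Wiener integrals. -/
theorem IsSecondOrderLevy.integral_wienerIntegral_mul (hL : IsSecondOrderLevy P L σ)
    (hst : s ≤ t) (hf : ∀ x, HasDerivAt f (f' x) x) (hf' : Continuous f')
    (hg : ∀ x, HasDerivAt g (g' x) x) (hg' : Continuous g') :
    ∫ ω, wienerIntegral L s t f f' ω * wienerIntegral L s t g g' ω ∂P =
      σ ^ 2 * ∫ x in (0 : ℝ)..(t - s), f x * g x := by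
  have hfc : Continuous f := continuous_iff_continuousAt.2 fun x => (hf x).continuousAt
  have hgc : Continuous g := continuous_iff_continuousAt.2 fun x => (hg x).continuousAt
  have hd : ∀ u, HasDerivAt (fun u => g (t - u)) (-g' (t - u)) u := fun u => by
    exact (hg (t - u)).comp_const_sub t u
  rw [hL.integral_mul_wienerIntegral hst hg' (hL.memLp_wienerIntegral hst hf')]
  simp_rw [mul_comm (wienerIntegral L s t f f' _)]
  rw [hL.integral_sub_mul_wienerIntegral hf hf' hst le_rfl]
  have h1 : ∫ u in s..t, g' (t - u) * ∫ ω, (L u ω - L s ω) * wienerIntegral L s t f f' ω ∂P =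
      ∫ u in s..t, g' (t - u) * (σ ^ 2 * ∫ v in s..u, f (t - v)) := by
    refine intervalIntegral.integral_congr fun u hu => ?_
    rw [Set.uIcc_of_le hst] at hu
    simp only [hL.integral_sub_mul_wienerIntegral hf hf' hu.1 hu.2]
  have hfk : Continuous fun u => f (t - u) := by fun_prop
  have hΓ : ∀ u, HasDerivAt (fun u => ∫ v in s..u, f (t - v)) (f (t - u)) u := fun u =>
    intervalIntegral.integral_hasDerivAt_right
    (hfk.intervalIntegrable _ _) (hfk.stronglyMeasurableAtFilter _ _) hfk.continuousAt
  have hΓc : Continuous fun u => ∫ v in s..u, f (t - v) :=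
    continuous_iff_continuousAt.2 fun u => (hΓ u).continuousAt
  have h2 := intervalIntegral.integral_eq_sub_of_hasDerivAt (a := s) (b := t)
    (f := fun u => (∫ v in s..u, f (t - v)) * g (t - u)) (fun u _ => (hΓ u).mul (hd u))
    (Continuous.intervalIntegrable (by fun_prop) _ _)
  have h3 := intervalIntegral.integral_comp_sub_left (a := s) (b := t) (fun x => f x * g x) t
  rw [sub_self] at h3
  rw [h1, ← h3]
  have h4 : ∫ u in s..t, g' (t - u) * (σ ^ 2 * ∫ v in s..u, f (t - v)) =
      σ ^ 2 * (∫ u in s..t, f (t - u) * g (t - u)) - σ ^ 2 * ∫ u in s..t,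
        (f (t - u) * g (t - u) + (∫ v in s..u, f (t - v)) * -g' (t - u)) := by
    rw [← mul_sub, ← intervalIntegral.integral_sub
      (Continuous.intervalIntegrable (by fun_prop) _ _)
      (Continuous.intervalIntegrable (by fun_prop) _ _), ← intervalIntegral.integral_const_mul]
    refine intervalIntegral.integral_congr fun u _ => ?_
    ring
  rw [h4, h2]
  simp only [sub_self, intervalIntegral.integral_same]
  ring

theorem IsSecondOrderLevy.integral_wienerIntegral_mul_of_le (hL : IsSecondOrderLevy P L σ)
    {s' t' : ℝ} (hst : s ≤ t) (hts : t ≤ s') (hst' : s' ≤ t') (hf' : Continuous f')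
    (hg' : Continuous g') :
    ∫ ω, wienerIntegral L s t f f' ω * wienerIntegral L s' t' g g' ω ∂P = 0 := by
  have h0 : ∀ u v, u ∈ Set.Icc s t → v ∈ Set.Icc s' t' →
      ∫ ω, (L v ω - L s' ω) * (L u ω - L s ω) ∂P = 0 := by
    intro u v hu hv
    rw [hL.integral_sub_mul_sub, abs_of_nonneg (by linarith [hu.1, hv.1]),
      abs_of_nonneg (by linarith [hu.2, hv.1]), abs_of_nonneg (by linarith [hu.2, hv.1]),
      abs_of_nonneg (by linarith [hu.1, hv.1])]
    ring
  have h1 : ∀ v ∈ Set.Icc s' t',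
      ∫ ω, wienerIntegral L s t f f' ω * (L v ω - L s' ω) ∂P = 0 := by
    intro v hv
    simp_rw [mul_comm (wienerIntegral L s t f f' _)]
    rw [hL.integral_mul_wienerIntegral hst hf' (hL.memLp_sub s' v),
      h0 t v (Set.right_mem_Icc.2 hst) hv, intervalIntegral.integral_congr (g := fun _ => 0)]
    · simp
    · intro u hu
      rw [Set.uIcc_of_le hst] at hu
      simp only [h0 u v hu hv, mul_zero]
  rw [hL.integral_mul_wienerIntegral hst' hg' (hL.memLp_wienerIntegral hst hf'),
    h1 t' (Set.right_mem_Icc.2 hst'), intervalIntegral.integral_congr (g := fun _ => 0)]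
  · simp
  · intro v hv
    rw [Set.uIcc_of_le hst'] at hv
    simp only [h1 v hv, mul_zero]

end Wiener

/-! ### Pathwise solution of the state equation -/

section Pathwise

variable {p : ℕ}

theorem hasDerivAt_dotProduct_exp (r v : Fin p → ℝ) (A : Matrix (Fin p) (Fin p) ℝ) (x : ℝ) :
    HasDerivAt (fun x : ℝ => r ⬝ᵥ (NormedSpace.exp (x • A) *ᵥ v))
      (r ⬝ᵥ (NormedSpace.exp (x • A) *ᵥ (A *ᵥ v))) x := by
  let l : Matrix (Fin p) (Fin p) ℝ →ₗ[ℝ] ℝ :=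
    { toFun := fun T => r ⬝ᵥ (T *ᵥ v)
      map_add' := fun S T => by rw [Matrix.add_mulVec, dotProduct_add]
      map_smul' := fun c T => by rw [Matrix.smul_mulVec, dotProduct_smul]; rfl }
  -- the topology and the exponential do not depend on the choice of this norm
  let _ : NormedRing (Matrix (Fin p) (Fin p) ℝ) := Matrix.linftyOpNormedRing
  let _ : NormedAlgebra ℝ (Matrix (Fin p) (Fin p) ℝ) := Matrix.linftyOpNormedAlgebra
  have h := (LinearMap.toContinuousLinearMap l).hasFDerivAt.comp_hasDerivAt x
    (hasDerivAt_exp_smul_const A x)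
  rw [Matrix.mulVec_mulVec]
  exact h

theorem continuous_dotProduct_exp (r v : Fin p → ℝ) (A : Matrix (Fin p) (Fin p) ℝ) :
    Continuous fun x : ℝ => r ⬝ᵥ (NormedSpace.exp (x • A) *ᵥ v) :=
  continuous_iff_continuousAt.2 fun x => (hasDerivAt_dotProduct_exp r v A x).continuousAt

/-- Variation of constants for `x' = A x + e ξ'` with a right-continuous path `ξ`, tested against
a row vector `r`: the function `x - ξ e` is continuous with right derivative `A x`. -/
theorem dotProduct_solution_eq {A : Matrix (Fin p) (Fin p) ℝ} {e : Fin p → ℝ}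
    {x : ℝ → Fin p → ℝ} {ξ : ℝ → ℝ} (hξ : ∀ t, ContinuousWithinAt ξ (Set.Ici t) t)
    (hint : ∀ (s t : ℝ) (i : Fin p), IntervalIntegrable (fun u => x u i) volume s t)
    (heq : ∀ (s t : ℝ) (i : Fin p),
      x t i - x s i = (∫ u in s..t, (A *ᵥ x u) i) + e i * (ξ t - ξ s))
    (r : Fin p → ℝ) {s t : ℝ} (hst : s ≤ t) :
    r ⬝ᵥ x t - r ⬝ᵥ (NormedSpace.exp ((t - s) • A) *ᵥ x s) =
      r ⬝ᵥ (NormedSpace.exp ((0 : ℝ) • A) *ᵥ e) * (ξ t - ξ s) +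
        ∫ u in s..t, r ⬝ᵥ (NormedSpace.exp ((t - u) • A) *ᵥ (A *ᵥ e)) * (ξ u - ξ s) := by
  set V : ℝ → Fin p → ℝ := fun u i => x u i - e i * (ξ u - ξ s) with hV
  have hAint : ∀ (i : Fin p) (s t : ℝ), IntervalIntegrable (fun u => (A *ᵥ x u) i) volume s t := by
    intro i s t
    simp only [Matrix.mulVec, dotProduct]
    have h := IntervalIntegrable.sum (μ := volume) (a := s) (b := t) Finset.univ
      (f := fun j u => A i j * x u j) fun j _ => (hint s t j).const_mul _
    simpa [Finset.sum_fn] using h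
  have hVeq : ∀ i u, V u i = x s i + ∫ v in s..u, (A *ᵥ x v) i := by
    intro i u
    have h := heq s u i
    simp only [hV]
    linarith
  have hVc : ∀ i, Continuous fun u => V u i := by
    intro i
    simp_rw [hVeq]
    exact continuous_const.add (intervalIntegral.continuous_primitive (hAint i) s)
  have hxc : ∀ i u, ContinuousWithinAt (fun u => x u i) (Set.Ici u) u := by
    intro i u
    have h : (fun u => x u i) = fun u => V u i + e i * (ξ u - ξ s) := by
      ext u
      simp only [hV]
      ring
    rw [h]
    exact (hVc i).continuousWithinAt.add
      (continuousWithinAt_const.mul ((hξ u).sub continuousWithinAt_const))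
  have hAc : ∀ i u, ContinuousWithinAt (fun u => (A *ᵥ x u) i) (Set.Ici u) u := by
    intro i u
    simp only [Matrix.mulVec, dotProduct]
    exact tendsto_finsetSum _ fun j _ => continuousWithinAt_const.mul (hxc j u)
  have hVd : ∀ i u, HasDerivWithinAt (fun u => V u i) ((A *ᵥ x u) i) (Set.Ioi u) u := by
    intro i u
    simp_rw [hVeq]
    refine HasDerivWithinAt.const_add _ ?_
    refine (intervalIntegral.integral_hasDerivWithinAt_right (s := Set.Ici u) (t := Set.Ioi u)
      (hAint i s u) ?_ ((hAc i u).mono Set.Ioi_subset_Ici_self)).mono Set.Ioi_subset_Ici_self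
    refine ⟨Set.Ioc u (u + 1), Ioc_mem_nhdsGT (by linarith), ?_⟩
    exact ((intervalIntegrable_iff_integrableOn_Ioc_of_le (by linarith)).1
      (hAint i u (u + 1))).aestronglyMeasurable
  -- the `i`-th coordinates of the row vectors `r exp ((t - u) A)`, and their derivatives
  set ρ : Fin p → ℝ → ℝ := fun i u => r ⬝ᵥ (NormedSpace.exp ((t - u) • A) *ᵥ Pi.single i 1) with hρ
  set ρ' : Fin p → ℝ → ℝ := fun i u =>
    r ⬝ᵥ (NormedSpace.exp ((t - u) • A) *ᵥ (A *ᵥ Pi.single i 1)) with hρ'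
  have hρd : ∀ i u, HasDerivAt (ρ i) (-ρ' i u) u := fun i u =>
    (hasDerivAt_dotProduct_exp r (Pi.single i 1) A (t - u)).comp_const_sub t u
  have hρc : ∀ i, Continuous (ρ i) := fun i =>
    continuous_iff_continuousAt.2 fun u => (hρd i u).continuousAt
  have hρc' : ∀ i, Continuous (ρ' i) := fun i =>
    (continuous_dotProduct_exp r (A *ᵥ Pi.single i 1) A).comp (continuous_const.sub continuous_id)
  have hsum : ∀ (T : Matrix (Fin p) (Fin p) ℝ) (v : Fin p → ℝ),
      ∑ i, r ⬝ᵥ (T *ᵥ Pi.single i 1) * v i = r ⬝ᵥ (T *ᵥ v) := by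
    intro T v
    rw [Matrix.dotProduct_mulVec]
    simp [dotProduct, Matrix.vecMul]
  have hsum' : ∀ u (v : Fin p → ℝ), ∑ i, ρ' i u * v i =
      r ⬝ᵥ (NormedSpace.exp ((t - u) • A) *ᵥ (A *ᵥ v)) := by
    intro u v
    simp only [hρ', Matrix.mulVec_mulVec]
    exact hsum _ v
  set w : ℝ → ℝ := fun u => ∑ i, ρ i u * V u i with hw
  have hFTC := intervalIntegral.integral_eq_sub_of_hasDeriv_right_of_le (f := w)
    (f' := fun u => ∑ i, (-ρ' i u * V u i + ρ i u * (A *ᵥ x u) i)) hst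
    (continuous_finsetSum _ fun i _ => (hρc i).mul (hVc i)).continuousOn
    (fun u _ => HasDerivWithinAt.fun_sum fun i _ => (hρd i u).hasDerivWithinAt.mul (hVd i u)) (by
      have h := IntervalIntegrable.sum (μ := volume) (a := s) (b := t) Finset.univ
        (f := fun i u => -ρ' i u * V u i + ρ i u * (A *ᵥ x u) i) fun i _ =>
          (((hρc' i).neg.mul (hVc i)).intervalIntegrable s t).add
            ((hAint i s t).continuousOn_mul (hρc i).continuousOn)
      simpa [Finset.sum_fn] using h)
  have hderiv : ∀ u, ∑ i, (-ρ' i u * V u i + ρ i u * (A *ᵥ x u) i) =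
      r ⬝ᵥ (NormedSpace.exp ((t - u) • A) *ᵥ (A *ᵥ e)) * (ξ u - ξ s) := by
    intro u
    have hVu : V u = x u - (ξ u - ξ s) • e := by
      ext i
      simp [hV, mul_comm]
    have hcomm : NormedSpace.exp ((t - u) • A) *ᵥ (A *ᵥ x u) =
        NormedSpace.exp ((t - u) • A) *ᵥ (A *ᵥ V u) +
          (ξ u - ξ s) • NormedSpace.exp ((t - u) • A) *ᵥ (A *ᵥ e) := by
      rw [hVu, Matrix.mulVec_sub, Matrix.mulVec_sub, Matrix.mulVec_smul, Matrix.mulVec_smul,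
        sub_add_cancel]
    rw [Finset.sum_add_distrib]
    simp only [neg_mul, Finset.sum_neg_distrib]
    rw [hsum' u, hsum, hcomm, dotProduct_add, dotProduct_smul, smul_eq_mul]
    ring
  simp_rw [hderiv] at hFTC
  have hwt : w t = r ⬝ᵥ x t -
      r ⬝ᵥ (NormedSpace.exp ((0 : ℝ) • A) *ᵥ e) * (ξ t - ξ s) := by
    have hVt : V t = x t - (ξ t - ξ s) • e := by
      ext i
      simp [hV, mul_comm]
    simp only [hw, hρ]
    rw [hsum, hVt, sub_self, zero_smul, NormedSpace.exp_zero, Matrix.one_mulVec, Matrix.one_mulVec,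
      dotProduct_sub, dotProduct_smul, smul_eq_mul, mul_comm]
  have hws : w s = r ⬝ᵥ (NormedSpace.exp ((t - s) • A) *ᵥ x s) := by
    have hVs : V s = x s := by
      ext i
      simp [hV]
    simp only [hw, hρ]
    rw [hsum, hVs]
  rw [hFTC, hwt, hws]
  ring

end Pathwise

/-! ### Moving averages of Wiener integrals over consecutive blocks -/

section Blocks

variable {Ω : Type*} [MeasurableSpace Ω] {P : Measure Ω}

theorem covariance_congr_ae {U V U' V' : Ω → ℝ} (hU : U =ᵐ[P] U') (hV : V =ᵐ[P] V') :
    cov[U, V; P] = cov[U', V'; P] := by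
  rw [covariance, covariance, integral_congr_ae hU, integral_congr_ae hV]
  refine integral_congr_ae ?_
  filter_upwards [hU, hV] with ω h1 h2
  rw [h1, h2]

variable {L : ℝ → Ω → ℝ} {σ : ℝ} [IsProbabilityMeasure P]

/-- Wiener integral over the `m`-th block `[(m - 1) Δ, m Δ]`. -/
def blockIntegral (L : ℝ → Ω → ℝ) (Δ : ℝ) (m : ℤ) (f f' : ℝ → ℝ) : Ω → ℝ :=
  wienerIntegral L (((m : ℝ) - 1) * Δ) (m * Δ) f f'

theorem IsSecondOrderLevy.covariance_blockIntegral (hL : IsSecondOrderLevy P L σ) {Δ : ℝ}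
    (hΔ : 0 < Δ) {f f' g g' : ℝ → ℝ} (hf : ∀ x, HasDerivAt f (f' x) x) (hf' : Continuous f')
    (hg : ∀ x, HasDerivAt g (g' x) x) (hg' : Continuous g') (m n : ℤ) :
    cov[blockIntegral L Δ m f f', blockIntegral L Δ n g g'; P] =
      if m = n then σ ^ 2 * ∫ x in (0 : ℝ)..Δ, f x * g x else 0 := by
  have hle : ∀ m : ℤ, ((m : ℝ) - 1) * Δ ≤ m * Δ := fun m => by nlinarith
  have hlt : ∀ m n : ℤ, m < n → (m : ℝ) * Δ ≤ ((n : ℝ) - 1) * Δ := by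
    intro m n hmn
    have : (m : ℝ) ≤ n - 1 := by exact_mod_cast Int.le_sub_one_of_lt hmn
    exact mul_le_mul_of_nonneg_right this hΔ.le
  simp only [blockIntegral]
  rw [covariance_eq_sub (hL.memLp_wienerIntegral (hle m) hf')
    (hL.memLp_wienerIntegral (hle n) hg')]
  simp only [Pi.mul_apply]
  rw [hL.integral_wienerIntegral (hle m) hf', zero_mul, sub_zero]
  rcases lt_trichotomy m n with h | h | h
  · rw [if_neg h.ne, hL.integral_wienerIntegral_mul_of_le (hle m) (hlt m n h) (hle n) hf' hg']
  · subst h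
    rw [if_pos rfl, hL.integral_wienerIntegral_mul (hle m) hf hf' hg hg']
    congr 3
    ring
  · simp_rw [mul_comm (wienerIntegral L (((m : ℝ) - 1) * Δ) _ _ _ _)]
    rw [if_neg h.ne', hL.integral_wienerIntegral_mul_of_le (hle n) (hlt n m h) (hle m) hg' hf']

/-- `U` is a moving average `U_n = ∑_{j < p} ∫ G_j dL`, the `j`-th integral being over the block
with number `n - j`. -/
structure IsBlockMovingAverage (P : Measure Ω) (L : ℝ → Ω → ℝ) (Δ : ℝ) (p : ℕ)
    (G G' : ℕ → ℝ → ℝ) (U : ℤ → Ω → ℝ) : Prop where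
  hasDerivAt : ∀ j x, HasDerivAt (G j) (G' j x) x
  continuous_deriv : ∀ j, Continuous (G' j)
  eq : ∀ n, U n =ᵐ[P] fun ω => ∑ j ∈ Finset.range p, blockIntegral L Δ (n - j) (G j) (G' j) ω

variable {Δ : ℝ} {p : ℕ} {G G' : ℕ → ℝ → ℝ} {U : ℤ → Ω → ℝ}

theorem IsBlockMovingAverage.covariance (hU : IsBlockMovingAverage P L Δ p G G' U)
    (hL : IsSecondOrderLevy P L σ) (hΔ : 0 < Δ) (m n : ℤ) :
    cov[U m, U n; P] = ∑ i ∈ Finset.range p, ∑ j ∈ Finset.range p,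
      if m - i = n - j then σ ^ 2 * ∫ x in (0 : ℝ)..Δ, G i x * G j x else 0 := by
  have hm : ∀ (k : ℤ) (j : ℕ), MemLp (blockIntegral L Δ k (G j) (G' j)) 2 P := fun k j =>
    hL.memLp_wienerIntegral (by nlinarith) (hU.continuous_deriv j)
  rw [covariance_congr_ae (hU.eq m) (hU.eq n),
    covariance_fun_sum_fun_sum' (fun i _ => hm _ i) (fun j _ => hm _ j)]
  refine Finset.sum_congr rfl fun i _ => Finset.sum_congr rfl fun j _ => ?_
  exact hL.covariance_blockIntegral hΔ (hU.hasDerivAt i) (hU.continuous_deriv i)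
    (hU.hasDerivAt j) (hU.continuous_deriv j) _ _

theorem IsBlockMovingAverage.isWeaklyStationary (hU : IsBlockMovingAverage P L Δ p G G' U)
    (hL : IsSecondOrderLevy P L σ) (hΔ : 0 < Δ) : IsWeaklyStationary P U := by
  have hle : ∀ m : ℤ, ((m : ℝ) - 1) * Δ ≤ m * Δ := fun m => by nlinarith
  have hm : ∀ (k : ℤ) (j : ℕ), MemLp (blockIntegral L Δ k (G j) (G' j)) 2 P := fun k j =>
    hL.memLp_wienerIntegral (hle k) (hU.continuous_deriv j)
  refine ⟨fun n => ?_, fun n => ?_, fun n h => ?_⟩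
  · exact (memLp_congr_ae (hU.eq n)).2 (memLp_finsetSum _ fun j _ => hm _ j)
  · rw [integral_congr_ae (hU.eq n), integral_finsetSum _ fun j _ => (hm _ j).integrable (by simp)]
    exact Finset.sum_eq_zero fun j _ =>
      hL.integral_wienerIntegral (hle _) (hU.continuous_deriv j)
  · rw [hU.covariance hL hΔ, hU.covariance hL hΔ]
    refine Finset.sum_congr rfl fun i _ => Finset.sum_congr rfl fun j _ => ?_
    congr 1
    simp only [eq_iff_iff]
    constructor <;> intro h <;> linarith

theorem IsBlockMovingAverage.autocov_eq_zero (hU : IsBlockMovingAverage P L Δ p G G' U)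
    (hL : IsSecondOrderLevy P L σ) (hΔ : 0 < Δ) {h : ℤ} (hh : (p : ℤ) ≤ |h|) :
    autocov P U h = 0 := by
  rw [autocov, hU.covariance hL hΔ]
  refine Finset.sum_eq_zero fun i hi => Finset.sum_eq_zero fun j hj => if_neg fun e => ?_
  rw [Finset.mem_range] at hi hj
  rcases le_abs.1 hh with h' | h' <;> omega

/-- The spectral density of a moving average of Wiener integrals is the integral of its squared
transfer function. -/
theorem IsBlockMovingAverage.spectralDensity_eq (hU : IsBlockMovingAverage P L Δ p G G' U)
    (hL : IsSecondOrderLevy P L σ) (hΔ : 0 < Δ) (w : ℝ) :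
    spectralDensity P U w = σ ^ 2 / (2 * Real.pi) * ∫ x in (0 : ℝ)..Δ,
      Complex.normSq (∑ j ∈ Finset.range p, Complex.exp (-(Complex.I * w)) ^ j * (G j x : ℂ)) := by
  set z := Complex.exp (-(Complex.I * w)) with hz
  have hGc : ∀ j, Continuous (G j) := fun j =>
    continuous_iff_continuousAt.2 fun x => (hU.hasDerivAt j x).continuousAt
  have hzz : ∀ i j : ℕ, Complex.exp (-(Complex.I * ((i - j : ℤ) : ℂ) * w)) =
      z ^ i * (starRingEnd ℂ) z ^ j := by
    intro i j
    rw [hz, ← Complex.exp_conj, ← Complex.exp_nat_mul, ← Complex.exp_nat_mul, ← Complex.exp_add]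
    congr 1
    simp only [map_neg, map_mul, Complex.conj_I, Complex.conj_ofReal]
    push_cast
    ring
  have hterm : ∀ h : ℤ, (autocov P U h : ℂ) * Complex.exp (-(Complex.I * h * w)) =
      ∑ i ∈ Finset.range p, ∑ j ∈ Finset.range p, if h = (i - j : ℤ) then
        ((σ ^ 2 * ∫ x in (0 : ℝ)..Δ, G i x * G j x : ℝ) : ℂ) *
          (z ^ i * (starRingEnd ℂ) z ^ j) else 0 := by
    intro h
    rw [autocov, hU.covariance hL hΔ, Complex.ofReal_sum, Finset.sum_mul]
    refine Finset.sum_congr rfl fun i _ => ?_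
    rw [Complex.ofReal_sum, Finset.sum_mul]
    refine Finset.sum_congr rfl fun j _ => ?_
    by_cases e : h = (i - j : ℤ)
    · rw [if_pos e, if_pos (by omega), e, hzz]
    · rw [if_neg e, if_neg (by omega), Complex.ofReal_zero, zero_mul]
  have hsum : ∑' h : ℤ, (autocov P U h : ℂ) * Complex.exp (-(Complex.I * h * w)) =
      ∑ i ∈ Finset.range p, ∑ j ∈ Finset.range p,
        ((σ ^ 2 * ∫ x in (0 : ℝ)..Δ, G i x * G j x : ℝ) : ℂ) *
          (z ^ i * (starRingEnd ℂ) z ^ j) := by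
    simp_rw [hterm]
    have hs : ∀ (k : ℤ) (y : ℂ), HasSum (fun h : ℤ => if h = k then y else 0) y :=
      fun k y => hasSum_ite_eq k y
    exact (hasSum_sum fun i _ => hasSum_sum fun j _ => hs _ _).tsum_eq
  have hint : ((∫ x in (0 : ℝ)..Δ, Complex.normSq (∑ j ∈ Finset.range p, z ^ j * (G j x : ℂ)) : ℝ)
      : ℂ) = ∑ i ∈ Finset.range p, ∑ j ∈ Finset.range p,
        ((∫ x in (0 : ℝ)..Δ, G i x * G j x : ℝ) : ℂ) * (z ^ i * (starRingEnd ℂ) z ^ j) := by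
    rw [← intervalIntegral.integral_ofReal]
    have e : ∀ x : ℝ, (Complex.normSq (∑ j ∈ Finset.range p, z ^ j * (G j x : ℂ)) : ℂ) =
        ∑ i ∈ Finset.range p, ∑ j ∈ Finset.range p,
          ((G i x * G j x : ℝ) : ℂ) * (z ^ i * (starRingEnd ℂ) z ^ j) := by
      intro x
      rw [← Complex.mul_conj, map_sum, Finset.sum_mul_sum]
      refine Finset.sum_congr rfl fun i _ => Finset.sum_congr rfl fun j _ => ?_
      rw [map_mul, map_pow, Complex.conj_ofReal]
      push_cast
      ring
    have hc : ∀ i j : ℕ, Continuous fun x => ((G i x * G j x : ℝ) : ℂ) *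
        (z ^ i * (starRingEnd ℂ) z ^ j) := fun i j =>
      (Complex.continuous_ofReal.comp ((hGc i).mul (hGc j))).mul continuous_const
    simp_rw [e]
    rw [intervalIntegral.integral_finsetSum fun i _ =>
      (continuous_finsetSum _ fun j _ => hc i j).intervalIntegrable _ _]
    refine Finset.sum_congr rfl fun i _ => ?_
    rw [intervalIntegral.integral_finsetSum fun j _ => (hc i j).intervalIntegrable _ _]
    refine Finset.sum_congr rfl fun j _ => ?_
    rw [intervalIntegral.integral_mul_const, intervalIntegral.integral_ofReal]
  rw [spectralDensity, hsum]
  have hfin : (1 / (2 * (Real.pi : ℂ)) * ∑ i ∈ Finset.range p, ∑ j ∈ Finset.range p,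
        ((σ ^ 2 * ∫ x in (0 : ℝ)..Δ, G i x * G j x : ℝ) : ℂ) *
          (z ^ i * (starRingEnd ℂ) z ^ j)) =
      ((σ ^ 2 / (2 * Real.pi) * ∫ x in (0 : ℝ)..Δ,
        Complex.normSq (∑ j ∈ Finset.range p, z ^ j * (G j x : ℂ)) : ℝ) : ℂ) := by
    rw [Complex.ofReal_mul (σ ^ 2 / (2 * Real.pi)), hint]
    simp_rw [Complex.ofReal_mul (σ ^ 2), mul_assoc, ← Finset.mul_sum]
    push_cast
    ring
  rw [hfin, Complex.ofReal_re]

end Blocks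

/-! ### The filtered sampled CARMA process -/

section Filtered

variable {p q : ℕ} {a b : ℝ[X]}

theorem aeval_exp_matrix_prod_eq_mul (A : Matrix (Fin p) (Fin p) ℂ) (t : ℂ) (S : Multiset ℂ) :
    ∃ T : Matrix (Fin p) (Fin p) ℂ,
      aeval (NormedSpace.exp (t • A)) (S.map fun l => X - C (Complex.exp (l * t))).prod =
        aeval A (S.map fun l => X - C l).prod * T := by
  let _ : NormedRing (Matrix (Fin p) (Fin p) ℂ) := Matrix.linftyOpNormedRing
  let _ : NormedAlgebra ℂ (Matrix (Fin p) (Fin p) ℂ) := Matrix.linftyOpNormedAlgebra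
  exact aeval_exp_prod_eq_mul A t S

theorem tendsto_integral_normSq_matrix_resolvent {z : ℂ} (hz : z ≠ 1) (m : ℕ)
    (A : Matrix (Fin p) (Fin p) ℂ) (l : Matrix (Fin p) (Fin p) ℂ →ₗ[ℂ] ℂ)
    (hl0 : ∀ k < m, l (A ^ k) = 0) (hlm : l (A ^ m) = 1)
    {N : ℝ → Matrix (Fin p) (Fin p) ℂ} {φ : ℝ → ℂ} {φ₀ : ℂ}
    (hN : ∀ Δ : ℝ, 0 < Δ → N Δ * (1 - z • NormedSpace.exp ((Δ : ℂ) • A)) = φ Δ • 1)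
    (hφ : Tendsto φ (𝓝[>] 0) (𝓝 φ₀)) :
    Tendsto (fun Δ : ℝ => (Δ ^ (2 * m + 1))⁻¹ *
        ∫ x in (0 : ℝ)..Δ, Complex.normSq (l (N Δ * NormedSpace.exp ((x : ℂ) • A))))
      (𝓝[>] 0) (𝓝 (∫ y in (0 : ℝ)..1, Complex.normSq (φ₀ * apostol z m y))) := by
  let _ : NormedRing (Matrix (Fin p) (Fin p) ℂ) := Matrix.linftyOpNormedRing
  let _ : NormedAlgebra ℂ (Matrix (Fin p) (Fin p) ℂ) := Matrix.linftyOpNormedAlgebra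
  exact tendsto_integral_normSq_resolvent hz m A (LinearMap.toContinuousLinearMap l) hl0 hlm hN hφ

/-- The complex companion matrix. -/
def stateMatrixC (p : ℕ) (a : ℝ[X]) : Matrix (Fin p) (Fin p) ℂ :=
  (algebraMap ℝ ℂ).mapMatrix (stateMatrix p a)

theorem mapMatrix_exp_smul (a : ℝ[X]) (x : ℝ) :
    (algebraMap ℝ ℂ).mapMatrix (NormedSpace.exp (x • stateMatrix p a)) =
      NormedSpace.exp ((x : ℂ) • stateMatrixC p a) := by
  have hc : Continuous ((algebraMap ℝ ℂ).mapMatrix : Matrix (Fin p) (Fin p) ℝ →+* _) :=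
    Continuous.matrix_map continuous_id Complex.continuous_ofReal
  have h : (algebraMap ℝ ℂ).mapMatrix (NormedSpace.exp (x • stateMatrix p a)) =
      NormedSpace.exp ((algebraMap ℝ ℂ).mapMatrix (x • stateMatrix p a)) := by
    let _ : NormedRing (Matrix (Fin p) (Fin p) ℝ) := Matrix.linftyOpNormedRing
    let _ : NormedAlgebra ℝ (Matrix (Fin p) (Fin p) ℝ) := Matrix.linftyOpNormedAlgebra
    let _ : NormedAlgebra ℚ (Matrix (Fin p) (Fin p) ℝ) := NormedAlgebra.restrictScalars ℚ ℝ _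
    let _ : NormedRing (Matrix (Fin p) (Fin p) ℂ) := Matrix.linftyOpNormedRing
    exact NormedSpace.map_exp
      ((algebraMap ℝ ℂ).mapMatrix : Matrix (Fin p) (Fin p) ℝ →+* Matrix (Fin p) (Fin p) ℂ) hc _
  rw [h]
  congr 1
  ext i j
  simp [stateMatrixC]

theorem card_roots_map (ha_deg : a.natDegree = p) :
    (a.map (algebraMap ℝ ℂ)).roots.card = p := by
  rw [← ha_deg, ← (IsAlgClosed.splits (a.map (algebraMap ℝ ℂ))).natDegree_eq_card_roots,
    natDegree_map]

theorem filterPolyC_eq_prod (a : ℝ[X]) (Δ : ℝ) :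
    filterPolyC a Δ = (((a.map (algebraMap ℝ ℂ)).roots.map
      fun l => Complex.exp (l * Δ)).map fun r => 1 - C r * X).prod := by
  rw [filterPolyC, Multiset.map_map]
  rfl

theorem coeff_filterPolyC_of_lt (ha_deg : a.natDegree = p) (Δ : ℝ) {k : ℕ} (hk : p < k) :
    (filterPolyC a Δ).coeff k = 0 := by
  rw [filterPolyC_eq_prod]
  refine coeff_prod_one_sub_of_card_lt _ ?_
  rwa [Multiset.card_map, card_roots_map ha_deg]

theorem natDegree_filterPoly_lt (ha_deg : a.natDegree = p) (Δ : ℝ) :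
    (filterPoly a Δ).natDegree < p + 1 := by
  rw [Nat.lt_succ_iff, natDegree_le_iff_coeff_eq_zero]
  intro k hk
  have h := coeff_filterPolyC_of_lt ha_deg Δ hk
  rw [← map_filterPoly, coeff_map] at h
  exact (map_eq_zero _).1 h

theorem mapMatrix_horner_filterPoly (Δ : ℝ) (j : ℕ) :
    (algebraMap ℝ ℂ).mapMatrix
      (horner (filterPoly a Δ) (NormedSpace.exp (Δ • stateMatrix p a)) j) =
      horner (filterPolyC a Δ) (NormedSpace.exp ((Δ : ℂ) • stateMatrixC p a)) j := by
  refine (map_horner (algebraMap ℝ ℂ) ((algebraMap ℝ ℂ).mapMatrix :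
    Matrix (Fin p) (Fin p) ℝ →+* Matrix (Fin p) (Fin p) ℂ)
    (fun r => by ext i j; by_cases h : i = j <;> simp [Matrix.algebraMap_matrix_apply, h])
    _ _ _).trans ?_
  rw [map_filterPoly, mapMatrix_exp_smul]

/-- Cayley–Hamilton: the zeroes of the filter polynomial are the inverses of the eigenvalues of
`exp (Δ A)`. -/
theorem horner_filterPoly_eq_zero (ha : a.Monic) (ha_deg : a.natDegree = p) (Δ : ℝ) :
    horner (filterPoly a Δ) (NormedSpace.exp (Δ • stateMatrix p a)) p = 0 := by
  have hinj : Function.Injective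
      ((algebraMap ℝ ℂ).mapMatrix : Matrix (Fin p) (Fin p) ℝ →+* Matrix (Fin p) (Fin p) ℂ) :=
    Matrix.map_injective Complex.ofReal_injective
  apply hinj
  rw [mapMatrix_horner_filterPoly, map_zero]
  have hcard : ((a.map (algebraMap ℝ ℂ)).roots.map fun l => Complex.exp (l * Δ)).card = p := by
    rw [Multiset.card_map, card_roots_map ha_deg]
  have h := horner_prod_one_sub ((a.map (algebraMap ℝ ℂ)).roots.map fun l => Complex.exp (l * Δ))
    (NormedSpace.exp ((Δ : ℂ) • stateMatrixC p a))
  rw [hcard, ← filterPolyC_eq_prod] at h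
  obtain ⟨T, hT⟩ := aeval_exp_matrix_prod_eq_mul (stateMatrixC p a) (Δ : ℂ)
    (a.map (algebraMap ℝ ℂ)).roots
  have hroots : ((a.map (algebraMap ℝ ℂ)).roots.map fun l => X - C l).prod =
      a.map (algebraMap ℝ ℂ) :=
    ((IsAlgClosed.splits _).eq_prod_roots_of_monic (ha.map _)).symm
  have hzero : aeval (stateMatrixC p a) (a.map (algebraMap ℝ ℂ)) = 0 := by
    have h0 := congrArg ((algebraMap ℝ ℂ).mapMatrix) (aeval_stateMatrix ha ha_deg)
    rw [map_zero] at h0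
    rw [← h0, aeval_eq_sum_range, aeval_eq_sum_range, natDegree_map, map_sum]
    refine Finset.sum_congr rfl fun k _ => ?_
    rw [coeff_map, stateMatrixC, ← map_pow]
    ext i j
    simp
  rw [h, Multiset.map_map]
  change aeval _ (Multiset.map (fun l => X - C (Complex.exp (l * Δ))) _).prod = 0
  rw [hT, hroots, hzero, zero_mul]

/-- The kernels of the filtered sampled process: on the `j`-th block into the past it is the Wiener
integral of `bᵀ N_j exp (x A) e_p`. -/
def filterKernel (p : ℕ) (a b : ℝ[X]) (Δ : ℝ) (j : ℕ) (x : ℝ) : ℝ :=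
  ((fun i : Fin p => b.coeff i) ᵥ*
    horner (filterPoly a Δ) (NormedSpace.exp (Δ • stateMatrix p a)) j) ⬝ᵥ
      (NormedSpace.exp (x • stateMatrix p a) *ᵥ lastVec p)

/-- The derivative of `filterKernel`. -/
def filterKernelDeriv (p : ℕ) (a b : ℝ[X]) (Δ : ℝ) (j : ℕ) (x : ℝ) : ℝ :=
  ((fun i : Fin p => b.coeff i) ᵥ*
    horner (filterPoly a Δ) (NormedSpace.exp (Δ • stateMatrix p a)) j) ⬝ᵥ
      (NormedSpace.exp (x • stateMatrix p a) *ᵥ (stateMatrix p a *ᵥ lastVec p))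

/-- Filtering annihilates the initial state, by Cayley–Hamilton, so that only the driving noise of
the last `p` blocks remains. -/
theorem isBlockMovingAverage_filtered {Ω : Type*} [MeasurableSpace Ω] {P : Measure Ω}
    {L Y : ℝ → Ω → ℝ} (ha : a.Monic) (ha_deg : a.natDegree = p) (hL : IsLevyProcess P L)
    (hY : IsCARMA P L p a b Y) {Δ : ℝ} (hΔ : 0 < Δ) :
    IsBlockMovingAverage P L Δ p (filterKernel p a b Δ) (filterKernelDeriv p a b Δ)
      (filtered a Y Δ) := by
  refine ⟨fun j x => hasDerivAt_dotProduct_exp _ _ _ x,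
    fun j => continuous_dotProduct_exp _ _ _, fun n => ?_⟩
  obtain ⟨-, X, hX, hYX⟩ := hY
  have hYX' : ∀ᵐ ω ∂P, ∀ m : ℤ, Y (m * Δ) ω = ∑ j : Fin p, b.coeff j * X (m * Δ) ω j :=
    ae_all_iff.2 fun m => hYX _
  filter_upwards [hYX', hX.intervalIntegrable, hX.equation, hL.cadlag] with ω hω hint heq hcad
  set M := NormedSpace.exp (Δ • stateMatrix p a) with hM
  set bv : Fin p → ℝ := fun i => b.coeff i
  set x : ℤ → Fin p → ℝ := fun m => X (m * Δ) ω
  set r : ℤ → Fin p → ℝ := fun m => x m - M *ᵥ x (m - 1) with hr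
  have hx : ∀ m, x m = M *ᵥ x (m - 1) + r m := fun m => by
    simp only [hr]
    abel
  have h := sum_filter_eq_horner (filterPoly a Δ) M hx n p
  rw [hM, horner_filterPoly_eq_zero ha ha_deg, Matrix.zero_mulVec, zero_add, ← hM] at h
  have hstep : ∀ (m : ℤ) (ρ : Fin p → ℝ), ρ ⬝ᵥ r m = blockIntegral L Δ m
      (fun x => ρ ⬝ᵥ (NormedSpace.exp (x • stateMatrix p a) *ᵥ lastVec p))
      (fun x => ρ ⬝ᵥ (NormedSpace.exp (x • stateMatrix p a) *ᵥ (stateMatrix p a *ᵥ lastVec p)))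
      ω := by
    intro m ρ
    have h1 := dotProduct_solution_eq (x := fun t => X t ω) (fun t => (hcad t).1) hint heq ρ
      (s := ((m : ℝ) - 1) * Δ) (t := m * Δ) (by nlinarith)
    rw [show (m : ℝ) * Δ - ((m : ℝ) - 1) * Δ = Δ by ring] at h1
    rw [blockIntegral, wienerIntegral, ← h1, hr, dotProduct_sub]
    simp only [x, hM]
    push_cast
    rfl
  have hleft : filtered a Y Δ n ω = bv ⬝ᵥ
      ∑ k ∈ Finset.range (p + 1), (filterPoly a Δ).coeff k • x (n - k) := by
    rw [filtered, applyFilter, sum_over_range' _ (by simp) _ (natDegree_filterPoly_lt ha_deg Δ),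
      dotProduct_sum]
    refine Finset.sum_congr rfl fun k _ => ?_
    rw [dotProduct_smul, sampled, hω]
    rfl
  rw [hleft, h, dotProduct_sum]
  refine Finset.sum_congr rfl fun j _ => ?_
  rw [Matrix.dotProduct_mulVec, hstep]
  rfl

/-- The linear functional `T ↦ bᵀ T e_p` on complex matrices. -/
def outputForm (p : ℕ) (b : ℝ[X]) : Matrix (Fin p) (Fin p) ℂ →ₗ[ℂ] ℂ :=
  { toFun := fun T => (algebraMap ℝ ℂ ∘ fun i : Fin p => b.coeff i) ⬝ᵥ
      (T *ᵥ (algebraMap ℝ ℂ ∘ lastVec p))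
    map_add' := fun S T => by rw [Matrix.add_mulVec, dotProduct_add]
    map_smul' := fun c T => by rw [Matrix.smul_mulVec, dotProduct_smul]; rfl }

theorem outputForm_mapMatrix (T : Matrix (Fin p) (Fin p) ℝ) :
    outputForm p b ((algebraMap ℝ ℂ).mapMatrix T) =
      (((fun i : Fin p => b.coeff i) ⬝ᵥ (T *ᵥ lastVec p) : ℝ) : ℂ) := by
  change _ ⬝ᵥ (T.map (algebraMap ℝ ℂ) *ᵥ _) =
    algebraMap ℝ ℂ ((fun i : Fin p => b.coeff i) ⬝ᵥ (T *ᵥ lastVec p))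
  rw [RingHom.map_dotProduct]
  congr 1
  ext i
  exact (RingHom.map_mulVec (algebraMap ℝ ℂ) T (lastVec p) i).symm

/-- The matrix transfer function `N(z) = ∑_{j < p} N_j z ^ j`. -/
def transferMatrix (p : ℕ) (a : ℝ[X]) (z : ℂ) (Δ : ℝ) : Matrix (Fin p) (Fin p) ℂ :=
  ∑ j ∈ Finset.range p,
    z ^ j • horner (filterPolyC a Δ) (NormedSpace.exp ((Δ : ℂ) • stateMatrixC p a)) j

theorem sum_pow_mul_filterKernel (z : ℂ) (Δ x : ℝ) :
    ∑ j ∈ Finset.range p, z ^ j * (filterKernel p a b Δ j x : ℂ) =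
      outputForm p b (transferMatrix p a z Δ *
        NormedSpace.exp ((x : ℂ) • stateMatrixC p a)) := by
  rw [transferMatrix, Finset.sum_mul, map_sum]
  refine Finset.sum_congr rfl fun j _ => ?_
  rw [smul_mul_assoc, map_smul, smul_eq_mul, ← mapMatrix_horner_filterPoly, ← mapMatrix_exp_smul,
    ← map_mul, outputForm_mapMatrix, filterKernel, ← Matrix.dotProduct_mulVec,
    Matrix.mulVec_mulVec]

/-- The transfer function is `φ(z) (1 - z exp (Δ A))⁻¹`, stated without inverses. -/
theorem transferMatrix_mul (ha : a.Monic) (ha_deg : a.natDegree = p) (z : ℂ) (Δ : ℝ) :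
    transferMatrix p a z Δ * (1 - z • NormedSpace.exp ((Δ : ℂ) • stateMatrixC p a)) =
      (filterPolyC a Δ).eval z • (1 : Matrix (Fin p) (Fin p) ℂ) := by
  rw [transferMatrix, sum_smul_horner_mul, ← mapMatrix_horner_filterPoly,
    horner_filterPoly_eq_zero ha ha_deg, map_zero, smul_zero, sub_zero,
    Algebra.algebraMap_eq_smul_one]
  have hdeg : (filterPolyC a Δ).natDegree < p + 1 := by
    rw [Nat.lt_succ_iff, natDegree_le_iff_coeff_eq_zero]
    exact fun k hk => coeff_filterPolyC_of_lt ha_deg Δ hk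
  rw [eval_eq_sum_range' hdeg]

theorem tendsto_eval_filterPolyC (ha_deg : a.natDegree = p) (z : ℂ) :
    Tendsto (fun Δ : ℝ => (filterPolyC a Δ).eval z) (𝓝[>] 0) (𝓝 ((1 - z) ^ p)) := by
  have h : ∀ S : Multiset ℂ, Tendsto (fun Δ : ℝ =>
      ((S.map fun l => 1 - C (Complex.exp (l * Δ)) * X).prod).eval z) (𝓝[>] 0)
      (𝓝 ((1 - z) ^ S.card)) := by
    intro S
    induction S using Multiset.induction_on with
    | empty => simp
    | cons l S ih =>
      simp only [Multiset.map_cons, Multiset.prod_cons, eval_mul, Multiset.card_cons, pow_succ']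
      refine Tendsto.mul ?_ ih
      have hc : Continuous fun Δ : ℝ =>
          (1 - C (Complex.exp (l * Δ)) * X : ℂ[X]).eval z := by
        simp only [eval_sub, eval_one, eval_mul, eval_C, eval_X]
        fun_prop
      have h0 := hc.tendsto 0
      simp only [Complex.ofReal_zero, mul_zero, Complex.exp_zero, eval_sub, eval_one, eval_mul,
        eval_C, eval_X, one_mul] at h0
      simpa using h0.mono_left nhdsWithin_le_nhds
  have h2 := h (a.map (algebraMap ℝ ℂ)).roots
  rw [card_roots_map ha_deg] at h2
  exact h2

theorem tendsto_integral_filterKernel (hqp : q < p) (ha : a.Monic) (ha_deg : a.natDegree = p)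
    (hb : b.Monic) (hb_deg : b.natDegree = q) {w : ℝ} (hw : Real.cos w < 1) :
    Tendsto (fun Δ : ℝ => (Δ ^ (2 * (p - q) - 1))⁻¹ * ∫ x in (0 : ℝ)..Δ,
        Complex.normSq (∑ j ∈ Finset.range p,
          Complex.exp (-(Complex.I * w)) ^ j * (filterKernel p a b Δ j x : ℂ)))
      (𝓝[>] 0) (𝓝 ((-1) ^ (p - q - 1) * c (p - q - 1) w * 2 ^ (p - 1) *
        (1 - Real.cos w) ^ p)) := by
  set z := Complex.exp (-(Complex.I * w)) with hz
  have hzr : z = Complex.exp ((-w : ℝ) * Complex.I) := by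
    rw [hz]
    congr 1
    push_cast
    ring
  have hz1 : ‖z‖ = 1 := by rw [hzr, Complex.norm_exp_ofReal_mul_I]
  have hzw : z.re = Real.cos w := by rw [hzr, Complex.exp_ofReal_mul_I_re, Real.cos_neg]
  have hzne : z ≠ 1 := by
    intro h
    rw [h, Complex.one_re] at hzw
    linarith
  have hmoment : ∀ k ≤ p - q - 1,
      outputForm p b (stateMatrixC p a ^ k) = if k = p - q - 1 then 1 else 0 := by
    intro k hk
    rw [stateMatrixC, ← map_pow, outputForm_mapMatrix,
      sum_coeff_mul_stateMatrix_pow hqp a hb hb_deg hk]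
    split_ifs <;> simp
  have h := tendsto_integral_normSq_matrix_resolvent hzne (p - q - 1) (stateMatrixC p a)
    (outputForm p b) (fun k hk => by rw [hmoment k hk.le, if_neg hk.ne])
    (by rw [hmoment _ le_rfl, if_pos rfl]) (fun Δ _ => transferMatrix_mul ha ha_deg z Δ)
    (tendsto_eval_filterPolyC ha_deg z)
  simp_rw [← sum_pow_mul_filterKernel] at h
  rw [show 2 * (p - q - 1) + 1 = 2 * (p - q) - 1 by omega] at h
  have hnorm : Complex.normSq (1 - z) = 2 * (1 - Real.cos w) := by
    have h1 : z.re * z.re + z.im * z.im = 1 := by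
      rw [← Complex.normSq_apply, Complex.normSq_eq_norm_sq, hz1, one_pow]
    rw [Complex.normSq_apply, Complex.sub_re, Complex.sub_im, Complex.one_re, Complex.one_im,
      ← hzw]
    linear_combination h1
  have hp : (2 : ℝ) ^ p = 2 * 2 ^ (p - 1) := by
    rw [← pow_succ', Nat.sub_add_cancel (by omega)]
  simp_rw [map_mul, map_pow, hnorm] at h
  rw [intervalIntegral.integral_const_mul, integral_normSq_apostol hw hz1 hzw, mul_pow, hp] at h
  convert h using 2
  ring

theorem c_ne_zero {w : ℝ} (hw : Real.cos w < 1) (k : ℕ) : c k w ≠ 0 := by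
  set z := Complex.exp ((w : ℂ) * Complex.I) with hz
  have hz1 : ‖z‖ = 1 := Complex.norm_exp_ofReal_mul_I w
  have hzw : z.re = Real.cos w := Complex.exp_ofReal_mul_I_re w
  have hzne : z ≠ 1 := by
    intro h
    rw [h, Complex.one_re] at hzw
    linarith
  intro h0
  have h := integral_normSq_apostol_pos hzne k
  rw [integral_normSq_apostol hw hz1 hzw, h0] at h
  simp at h

end Filtered

end CARMA

end

theorem theorem3p1 {Ω : Type*} [MeasurableSpace Ω] (P : Measure Ω) [IsProbabilityMeasure P]
    (p q : ℕ) (hqp : q < p) (a b : ℝ[X])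
    (ha_monic : a.Monic) (ha_deg : a.natDegree = p)
    (hb_monic : b.Monic) (hb_deg : b.natDegree = q)
    (hab : ∀ z : ℂ, ¬ (aeval z a = 0 ∧ aeval z b = 0))
    (ha_roots : ∀ z : ℂ, aeval z a = 0 → z.re < 0)
    (σ : ℝ) (hσ : 0 < σ) (L : ℝ → Ω → ℝ) (hL : CARMA.IsSecondOrderLevy P L σ)
    (Y : ℝ → Ω → ℝ) (hY : CARMA.IsCARMA P L p a b Y) :
    -- the filtered sampled sequence is weakly stationary and `(p - 1)`-correlated
    (∀ Δ : ℝ, 0 < Δ → CARMA.IsWeaklyStationary P (CARMA.filtered a Y Δ) ∧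
      ∀ h : ℤ, (p : ℤ) ≤ |h| → CARMA.autocov P (CARMA.filtered a Y Δ) h = 0) ∧
    -- the moving-average part of any ARMA representation has the same spectral density
    (∀ Δ : ℝ, 0 < Δ → ∀ (θ : ℝ[X]) (v : ℝ) (Z : ℤ → Ω → ℝ),
      CARMA.IsARMARepresentation P p a Y Δ θ v Z → ∀ w : ℝ,
        CARMA.spectralDensity P (CARMA.applyFilter θ Z) w =
          CARMA.spectralDensity P (CARMA.filtered a Y Δ) w) ∧
    ∀ w ∈ Set.Icc (-Real.pi) Real.pi, w ≠ 0 →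
      -- asymptotic form as `Δ ↓ 0`
      Tendsto (fun Δ : ℝ => CARMA.spectralDensity P (CARMA.filtered a Y Δ) w /
          (σ ^ 2 / (2 * Real.pi) * (-1) ^ (p - q - 1) * Δ ^ (2 * (p - q) - 1) *
            CARMA.c (p - q - 1) w * 2 ^ (p - 1) * (1 - Real.cos w) ^ p))
        (𝓝[>] 0) (𝓝 1) ∧
      -- the power series defining the coefficients
      (∀ᶠ x in 𝓝 (0 : ℝ), HasSum (fun k : ℕ => CARMA.c k w * x ^ (2 * k + 1))
        (Real.sinh x / (Real.cosh x - Real.cos w))) ∧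
      CARMA.c 0 w = 1 / (1 - Real.cos w) ∧
      CARMA.c 1 w = -((2 + Real.cos w) / (6 * (1 - Real.cos w) ^ 2)) ∧
      CARMA.c 2 w = (33 + 26 * Real.cos w + Real.cos (2 * w)) /
        (240 * (1 - Real.cos w) ^ 3) := by
  have hU : ∀ Δ : ℝ, 0 < Δ → CARMA.IsBlockMovingAverage P L Δ p (CARMA.filterKernel p a b Δ)
      (CARMA.filterKernelDeriv p a b Δ) (CARMA.filtered a Y Δ) := fun Δ hΔ =>
    CARMA.isBlockMovingAverage_filtered ha_monic ha_deg hL.toIsLevyProcess hY hΔ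
  refine ⟨fun Δ hΔ => ⟨(hU Δ hΔ).isWeaklyStationary hL hΔ,
    fun h hh => (hU Δ hΔ).autocov_eq_zero hL hΔ hh⟩, fun Δ _ θ v Z hZ w => ?_,
    fun w hw h0 => ?_⟩
  · have h : CARMA.autocov P (CARMA.applyFilter θ Z) = CARMA.autocov P (CARMA.filtered a Y Δ) := by
      ext h
      exact (CARMA.covariance_congr_ae (hZ.equation h) (hZ.equation 0)).symm
    rw [CARMA.spectralDensity, CARMA.spectralDensity, h]
  have hcos := CARMA.cos_lt_one_of_mem_Icc hw h0
  refine ⟨?_, CARMA.hasSum_c hcos, CARMA.c_zero_one_two hcos⟩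
  have hlim := CARMA.tendsto_integral_filterKernel hqp ha_monic ha_deg hb_monic hb_deg hcos
  have hσ2 : σ ^ 2 / (2 * Real.pi) ≠ 0 := by positivity
  have hK : (-1) ^ (p - q - 1) * CARMA.c (p - q - 1) w * 2 ^ (p - 1) * (1 - Real.cos w) ^ p ≠ 0 :=
    mul_ne_zero (mul_ne_zero (mul_ne_zero (pow_ne_zero _ (by norm_num)) (CARMA.c_ne_zero hcos _))
      (by positivity)) (pow_ne_zero _ (by linarith))
  have h1 := hlim.div_const
    ((-1) ^ (p - q - 1) * CARMA.c (p - q - 1) w * 2 ^ (p - 1) * (1 - Real.cos w) ^ p)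
  rw [div_self hK] at h1
  refine h1.congr' ?_
  filter_upwards [self_mem_nhdsWithin] with Δ hΔ
  rw [(hU Δ hΔ).spectralDensity_eq hL hΔ w,
    show σ ^ 2 / (2 * Real.pi) * (-1) ^ (p - q - 1) * Δ ^ (2 * (p - q) - 1) *
      CARMA.c (p - q - 1) w * 2 ^ (p - 1) * (1 - Real.cos w) ^ p =
      σ ^ 2 / (2 * Real.pi) * (Δ ^ (2 * (p - q) - 1) * ((-1) ^ (p - q - 1) *
        CARMA.c (p - q - 1) w * 2 ^ (p - 1) * (1 - Real.cos w) ^ p)) by ring,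
    mul_div_mul_left _ _ hσ2, inv_mul_eq_div, div_div]
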